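/- **Setting.** For a measurable space $\Omega$ let $\mathcal P(\Omega)$ be the set of probability measures on $\Omega$. For an integer $k\ge 1$ let $\mathcal S^{1/k}(\Omega)$ be the space of $1/k$-th powers of finite signed measures, i.e. the direct limit of the spaces $\{\phi\,\mu^{1/k} : \phi\in L^k(\Omega,\mu)\}$ over all finite measures $\mu$ on $\Omega$ (directed by domination), with the inclusions $\phi\,\mu^{1/k}=\phi\,(d\mu/d\nu)^{1/k}\,\nu^{1/k}$ for $\mu\ll\nu$ and the norm $\|\phi\,\mu^{1/k}\|=\|\phi\|_{L^k(\Omega,\mu)}$; in particular $\mathcal S^1(\Omega)=\mathcal S(\Omega)$ is the space of finite signed measures. Let $\mathcal P^{1/k}(\Omega)=\{\mu^{1/k}:\mu\in\mathcal P(\Omega)\}\subset\mathcal S^{1/k}(\Omega)$ with the induced topology and tangent spaces $$T_{\mu^{1/k}}\mathcal P^{1/k}(\Omega)=\{\phi\,\mu^{1/k} : \phi\in L^k(\Omega,\mu),\ \textstyle\int\phi\,d\mu=0\}.$$ A vector field on $\mathcal P^{1/k}(\Omega)$ is a continuous map $X:\mathcal P^{1/k}(\Omega)\to\mathcal S^{1/k}(\Omega)$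 with $X_{\mu^{1/k}}\in T_{\mu^{1/k}}\mathcal P^{1/k}(\Omega)$. An $n$-tensor on $\mathcal P^{1/k}(\Omega)$ is a collection of $n$-multilinear forms $\Psi_{\mu^{1/k}}$ on the tangent spaces such that $\mu^{1/k}\mapsto\Psi_{\mu^{1/k}}(X^1,\dots,X^n)$ is continuous for all vector fields $X^1,\dots,X^n$. The canonical $n$-tensor on $\mathcal S^{1/n}(\Omega)$ is $$L^n_\Omega(\phi_1\mu^{1/n},\dots,\phi_n\mu^{1/n})=n^n\int_\Omega\phi_1\cdots\phi_n\,d\mu .$$ The Fisher metric $\mathfrak g_F$ on $\mathcal P^{1/2}(\Omega)$ and the Amari–Chentsov tensor $\mathbf T$ on $\mathcal P^{1/3}(\Omega)$ are the restrictions of $L^2_\Omega$ and $L^3_\Omega$ to the tangent spaces. A Markov kernel $K:\Omega\to\mathcal P(\Omega')$ with Markov morphism $K_*\mu(A)=\int K(\omega;A)\,d\mu(\omega)$ is congruent if there is a measurable map $\kappa:\Omega'\to\Omega$ with $\kappa_*K(\omega)=\delta_\omega$ for all $\omega$. Its formal derivative at $\mu^{1/k}$ is $$dK_{1/k}(\phi\,\mu^{1/k})=\frac{d\{K_*(\phi\mu)\}}{d\{K_*\mu\}}\,(K_*\mu)^{1/k}.$$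 A family $(\Theta^n_\Omega)$ of $n$-tensors on $\mathcal P^{1/k}(\Omega)$, one for each measurable space $\Omega$, is congruent if for every congruent Markov kernel $K:\Omega\to\mathcal P(\Omega')$ and all $\mu\in\mathcal P(\Omega)$, $V_1,\dots,V_n\in T_{\mu^{1/k}}\mathcal P^{1/k}(\Omega)$, $$(\Theta^n_{\Omega'})_{(K_*\mu)^{1/k}}(dK_{1/k}V_1,\dots,dK_{1/k}V_n)=(\Theta^n_\Omega)_{\mu^{1/k}}(V_1,\dots,V_n).$$ A $k$-integrable statistical model $(M,\Omega,\mathbf p)$ is a (finite or infinite dimensional) manifold $M$ without boundary with a map $\mathbf p:M\to\mathcal P(\Omega)$ such that $\mathbf p:M\to\mathcal S(\Omega)$ and $\mathbf p^{1/k}:M\to\mathcal S^{1/k}(\Omega)$ are Fréchet differentiable. The Fisher metric of a $2$-integrable model is $\mathfrak g_M=(\mathbf p^{1/2})^*L^2_\Omega$, and the Amari–Chentsov tensor of a $3$-integrable model is $\mathbf T_M=(\mathbf p^{1/3})^*L^3_\Omega$. **Theorem (generalization of Chentsov's theorem).** 1. Let $(\Theta^2_\Omega)$ be a congruent family of $2$-tensors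 on $\mathcal P^{1/2}(\Omega)$. Then there is a constant $c\in\mathbb R$ such that $\Theta^2_\Omega=c\,\mathfrak g_F$ for all measurable spaces $\Omega$. Moreover, with the same $c$, for every $2$-integrable statistical model $(M,\Omega,\mathbf p)$ the differentials $d_\xi\mathbf p^{1/2}(v)$ are tangent to $\mathcal P^{1/2}(\Omega)$ at $\mathbf p(\xi)^{1/2}$, and $(\mathbf p^{1/2})^*\Theta^2_\Omega=c\,\mathfrak g_M$. 2. Let $(\Theta^3_\Omega)$ be a congruent family of $3$-tensors on $\mathcal P^{1/3}(\Omega)$. Then there is a constant $c\in\mathbb R$ such that $\Theta^3_\Omega=c\,\mathbf T$ for all measurable spaces $\Omega$. Moreover, with the same $c$, for every $3$-integrable statistical model $(M,\Omega,\mathbf p)$ the differentials $d_\xi\mathbf p^{1/3}(v)$ are tangent to $\mathcal P^{1/3}(\Omega)$ at $\mathbf p(\xi)^{1/3}$, and $(\mathbf p^{1/3})^*\Theta^3_\Omega=c\,\mathbf T_M$. -/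

import Mathlib

open MeasureTheory ProbabilityTheory
open scoped ENNReal Manifold

universe u v w x

noncomputable section

namespace RootMeasure

instance factOneLeCast (k : ℕ) [NeZero k] : Fact (1 ≤ (k : ℝ≥0∞)) :=
  ⟨by exact_mod_cast Nat.one_le_iff_ne_zero.mpr (NeZero.ne k)⟩

/-- Finite measures on `Ω`, preordered by domination: `μ ≤ ν` means `μ ≪ ν`. -/
structure FinMeasure (Ω : Type u) [MeasurableSpace Ω] where
  val : Measure Ω
  finite : IsFiniteMeasure val

attribute [instance] FinMeasure.finite

section PowersOfMeasures

variable {Ω : Type u} [MeasurableSpace Ω]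

instance : Preorder (FinMeasure Ω) where
  le μ ν := μ.val ≪ ν.val
  le_refl _ := Measure.AbsolutelyContinuous.rfl
  le_trans _ _ _ h h' := h.trans h'

instance : IsDirectedOrder (FinMeasure Ω) :=
  ⟨fun μ ν => ⟨⟨μ.val + ν.val, inferInstance⟩,
    Measure.AbsolutelyContinuous.rfl.add_right _,
    by
      change ν.val ≪ μ.val + ν.val
      rw [add_comm]
      exact Measure.AbsolutelyContinuous.rfl.add_right _⟩⟩

instance : Nonempty (FinMeasure Ω) := ⟨⟨0, inferInstance⟩⟩

/-- If `μ ≪ ν`, then `φ μ^{1/k} = φ (dμ/dν)^{1/k} ν^{1/k}`; this is the new coefficient. -/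
def transFun (k : ℕ) (μ ν : Measure Ω) (φ : Ω → ℝ) (x : Ω) : ℝ :=
  φ x * ((μ.rnDeriv ν x).toReal) ^ ((k : ℝ)⁻¹)

theorem transFun_congr (k : ℕ) [NeZero k] {μ ν : Measure Ω} [IsFiniteMeasure μ]
    [IsFiniteMeasure ν] (h : μ ≪ ν) {φ ψ : Ω → ℝ} (e : φ =ᵐ[μ] ψ) :
    transFun k μ ν φ =ᵐ[ν] transFun k μ ν ψ := by
  have e' : ∀ᵐ x ∂(ν.withDensity (μ.rnDeriv ν)), φ x = ψ x := by
    rw [Measure.withDensity_rnDeriv_eq μ ν h]; exact e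
  rw [ae_withDensity_iff (Measure.measurable_rnDeriv μ ν)] at e'
  filter_upwards [e'] with x hx
  by_cases h0 : μ.rnDeriv ν x = 0
  · have hk : ((k : ℝ)⁻¹) ≠ 0 := inv_ne_zero (Nat.cast_ne_zero.mpr (NeZero.ne k))
    simp [transFun, h0, Real.zero_rpow hk]
  · simp [transFun, hx h0]

theorem eLpNorm_transFun (k : ℕ) [NeZero k] {μ ν : Measure Ω} [IsFiniteMeasure μ]
    [IsFiniteMeasure ν] (h : μ ≪ ν) {φ : Ω → ℝ} (hφ : StronglyMeasurable φ) :
    eLpNorm (transFun k μ ν φ) k ν = eLpNorm φ k μ := by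
  have hk : (k : ℝ≥0∞) ≠ 0 := by exact_mod_cast NeZero.ne k
  have hkR : (k : ℝ) ≠ 0 := Nat.cast_ne_zero.mpr (NeZero.ne k)
  rw [eLpNorm_eq_lintegral_rpow_enorm_toReal hk (ENNReal.natCast_ne_top k),
    eLpNorm_eq_lintegral_rpow_enorm_toReal hk (ENNReal.natCast_ne_top k)]
  congr 1
  rw [← lintegral_rnDeriv_mul h (hφ.measurable.enorm.pow_const _).aemeasurable]
  apply lintegral_congr_ae
  filter_upwards [Measure.rnDeriv_lt_top μ ν] with x hx
  have h1 : ‖((μ.rnDeriv ν x).toReal) ^ ((k : ℝ)⁻¹)‖ₑ = (μ.rnDeriv ν x) ^ ((k : ℝ)⁻¹) := by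
    rw [Real.enorm_eq_ofReal (by positivity),
      ← ENNReal.ofReal_rpow_of_nonneg ENNReal.toReal_nonneg (by positivity),
      ENNReal.ofReal_toReal hx.ne]
  simp only [transFun, enorm_mul, h1, ENNReal.toReal_natCast]
  rw [ENNReal.mul_rpow_of_nonneg _ _ (by positivity), ← ENNReal.rpow_mul,
    inv_mul_cancel₀ hkR, ENNReal.rpow_one, mul_comm]

theorem memLp_transFun (k : ℕ) [NeZero k] {μ ν : Measure Ω} [IsFiniteMeasure μ]
    [IsFiniteMeasure ν] (h : μ ≪ ν) (φ : Lp ℝ k μ) : MemLp (transFun k μ ν φ) k ν := by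
  refine ⟨?_, ?_⟩
  · exact ((Lp.stronglyMeasurable φ).measurable.mul
      ((Measure.measurable_rnDeriv μ ν).ennreal_toReal.pow_const _)).aestronglyMeasurable
  · rw [eLpNorm_transFun k h (Lp.stronglyMeasurable φ)]
    exact Lp.eLpNorm_lt_top φ

/-- The isometric inclusion `S^{1/k}(Ω; μ) → S^{1/k}(Ω; ν)` for `μ ≪ ν`, written on the
coefficients: `φ ↦ φ (dμ/dν)^{1/k}`. -/
def trans (k : ℕ) [NeZero k] (μ ν : FinMeasure Ω) (h : μ ≤ ν) :
    Lp ℝ k μ.val →ₗᵢ[ℝ] Lp ℝ k ν.val where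
  toFun φ := (memLp_transFun k h φ).toLp _
  map_add' φ ψ := by
    rw [← MemLp.toLp_add]
    apply MemLp.toLp_congr
    refine (transFun_congr k h (Lp.coeFn_add φ ψ)).trans (Filter.Eventually.of_forall fun x => ?_)
    simp [transFun, add_mul]
  map_smul' c φ := by
    rw [RingHom.id_apply, ← MemLp.toLp_const_smul]
    apply MemLp.toLp_congr
    refine (transFun_congr k h (Lp.coeFn_smul c φ)).trans (Filter.Eventually.of_forall fun x => ?_)
    simp [transFun, mul_assoc]
  norm_map' φ := by
    change ‖(memLp_transFun k h φ).toLp _‖ = _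
    rw [Lp.norm_toLp, eLpNorm_transFun k h (Lp.stronglyMeasurable φ)]
    rfl

theorem coeFn_trans (k : ℕ) [NeZero k] {μ ν : FinMeasure Ω} (h : μ ≤ ν) (φ : Lp ℝ k μ.val) :
    trans k μ ν h φ =ᵐ[ν.val] transFun k μ.val ν.val φ :=
  MemLp.coeFn_toLp (memLp_transFun k h φ)

instance (k : ℕ) [NeZero k] :
    DirectedSystem (fun μ : FinMeasure Ω => Lp ℝ k μ.val) (trans k · · ·) where
  map_self μ φ := by
    apply Lp.ext
    filter_upwards [coeFn_trans k (le_refl μ) φ, Measure.rnDeriv_self μ.val] with x hx h1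
    rw [hx, transFun, h1]; simp
  map_map μ ν ρ h h' φ := by
    apply Lp.ext
    filter_upwards [coeFn_trans k h' (trans k _ _ h φ), coeFn_trans k (h.trans h') φ,
      transFun_congr k h' (coeFn_trans k h φ),
      Measure.rnDeriv_mul_rnDeriv (κ := μ.val) h] with x h1 h2 h3 h4
    rw [h1, h2, h3, transFun, transFun, transFun, ← h4, Pi.mul_apply, ENNReal.toReal_mul,
      Real.mul_rpow ENNReal.toReal_nonneg ENNReal.toReal_nonneg, mul_assoc]

end PowersOfMeasures

/-- The space `S^{1/k}(Ω)` of `1/k`-th powers of finite signed measures: the direct limit of the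
spaces `S^{1/k}(Ω; μ) = {φ μ^{1/k} | φ ∈ L^k(Ω, μ)}` over all finite measures `μ`, directed by
domination, along the isometric inclusions `φ μ^{1/k} = φ (dμ/dν)^{1/k} ν^{1/k}` for `μ ≪ ν`. -/
def RootSpace (k : ℕ) [NeZero k] (Ω : Type u) [MeasurableSpace Ω] : Type u :=
  DirectLimit (fun μ : FinMeasure Ω => Lp ℝ k μ.val) (trans k)

section RootSpace

variable {k : ℕ} [NeZero k] {Ω : Type u} [MeasurableSpace Ω]

instance : AddCommGroup (RootSpace k Ω) :=
  inferInstanceAs (AddCommGroup (DirectLimit (fun μ : FinMeasure Ω => Lp ℝ k μ.val) (trans k)))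

instance : Module ℝ (RootSpace k Ω) :=
  inferInstanceAs (Module ℝ (DirectLimit (fun μ : FinMeasure Ω => Lp ℝ k μ.val) (trans k)))

/-- The element `φ μ^{1/k}` of `S^{1/k}(Ω)`, linear in `φ ∈ L^k(Ω, μ)`. -/
def dominated (k : ℕ) [NeZero k] (μ : FinMeasure Ω) : Lp ℝ k μ.val →ₗ[ℝ] RootSpace k Ω where
  toFun φ := (⟦⟨μ, φ⟩⟧ : DirectLimit (fun μ : FinMeasure Ω => Lp ℝ k μ.val) (trans k))
  map_add' φ ψ := (DirectLimit.add_def (f := trans k) μ φ ψ).symm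
  map_smul' c φ := (DirectLimit.smul_def (f := trans k) μ φ c).symm

theorem dominated_trans {μ ν : FinMeasure Ω} (h : μ ≤ ν) (φ : Lp ℝ k μ.val) :
    dominated k ν (trans k μ ν h φ) = dominated k μ φ := by
  have e := DirectLimit.eq_of_le (F := fun μ : FinMeasure Ω => Lp ℝ k μ.val) (f := trans k)
    ⟨μ, φ⟩ ν h
  exact e.symm

theorem dominated_injective (μ : FinMeasure Ω) : Function.Injective (dominated k μ) :=
  DirectLimit.mk_injective (trans k) (fun μ ν h => (trans k μ ν h).injective) μ

theorem exists_dominated (x : RootSpace k Ω) : ∃ μ φ, x = dominated k μ φ :=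
  DirectLimit.exists_eq_mk (trans k) x

theorem exists_dominated₂ (x y : RootSpace k Ω) :
    ∃ μ φ ψ, x = dominated k μ φ ∧ y = dominated k μ ψ :=
  DirectLimit.exists_eq_mk₂ (trans k) x y

/-- Finitely many elements of `S^{1/k}(Ω)` are dominated by one finite measure. -/
theorem exists_dominated_family {n : ℕ} (x : Fin n → RootSpace k Ω) :
    ∃ (μ : FinMeasure Ω) (φ : Fin n → Lp ℝ k μ.val), ∀ i, x i = dominated k μ (φ i) := by
  choose ν ψ h using fun i => exists_dominated (x i)
  obtain ⟨μ, hμ⟩ := Finite.exists_le ν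
  exact ⟨μ, fun i => trans k _ _ (hμ i) (ψ i), fun i => by rw [dominated_trans, h]⟩

/-- The norm of `S^{1/k}(Ω)`: the norm of `φ μ^{1/k}` is the `L^k(Ω, μ)`-norm of `φ`. -/
instance : Norm (RootSpace k Ω) where
  norm := DirectLimit.lift (trans k) (fun _ φ => ‖φ‖)
    (fun μ ν h φ => ((trans k μ ν h).norm_map φ).symm)

theorem norm_dominated (μ : FinMeasure Ω) (φ : Lp ℝ k μ.val) : ‖dominated k μ φ‖ = ‖φ‖ := rfl

theorem normCore : NormedSpace.Core ℝ (RootSpace k Ω) where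
  norm_nonneg x := by
    obtain ⟨μ, φ, rfl⟩ := exists_dominated x
    exact norm_nonneg φ
  norm_smul c x := by
    obtain ⟨μ, φ, rfl⟩ := exists_dominated x
    rw [← map_smul, norm_dominated, norm_dominated, norm_smul]
  norm_triangle x y := by
    obtain ⟨μ, φ, ψ, rfl, rfl⟩ := exists_dominated₂ x y
    rw [← map_add, norm_dominated, norm_dominated, norm_dominated]
    exact norm_add_le φ ψ
  norm_eq_zero_iff x := by
    obtain ⟨μ, φ, rfl⟩ := exists_dominated x
    rw [norm_dominated, norm_eq_zero, map_eq_zero_iff _ (dominated_injective μ)]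

instance : NormedAddCommGroup (RootSpace k Ω) := NormedAddCommGroup.ofCore normCore

instance : NormedSpace ℝ (RootSpace k Ω) := NormedSpace.ofCore normCore

end RootSpace

section Probability

variable {Ω : Type u} [MeasurableSpace Ω]

/-- A probability measure, regarded as a finite measure. -/
def toFin (μ : ProbabilityMeasure Ω) : FinMeasure Ω := ⟨μ, inferInstance⟩

instance (μ : ProbabilityMeasure Ω) : IsProbabilityMeasure (toFin μ).val :=
  inferInstanceAs (IsProbabilityMeasure (μ : Measure Ω))

/-- The root `μ^{1/k} ∈ S^{1/k}(Ω)` of a probability measure `μ`. -/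
def root (k : ℕ) [NeZero k] (μ : ProbabilityMeasure Ω) : RootSpace k Ω :=
  dominated k (toFin μ) ((memLp_const (1 : ℝ)).toLp _)

/-- Elements of `L^k(Ω, μ)` have zero mean if their integral over the probability measure `μ`
vanishes. -/
def meanZero (k : ℕ) [NeZero k] (μ : ProbabilityMeasure Ω) :
    Submodule ℝ (Lp ℝ k (toFin μ).val) where
  carrier := {φ | ∫ x, φ x ∂(toFin μ).val = 0}
  zero_mem' := by
    have e := integral_congr_ae (Lp.coeFn_zero ℝ k (toFin μ).val)
    simp only [Pi.zero_apply, integral_zero] at e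
    exact e
  add_mem' {φ ψ} hφ hψ := by
    have e := integral_congr_ae (Lp.coeFn_add φ ψ)
    have hk : (1 : ℝ≥0∞) ≤ k := Fact.out
    simp only [Set.mem_ofPred_eq] at hφ hψ ⊢
    rw [e]
    simp only [Pi.add_apply]
    rw [integral_add ((Lp.memLp φ).integrable hk) ((Lp.memLp ψ).integrable hk), hφ, hψ, add_zero]
  smul_mem' c φ hφ := by
    have e := integral_congr_ae (Lp.coeFn_smul c φ)
    simp only [Set.mem_ofPred_eq] at hφ ⊢
    rw [e]
    simp only [Pi.smul_apply]
    rw [integral_smul, hφ, smul_zero]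

/-- The tangent space of `P^{1/k}(Ω)` at `μ^{1/k}`, namely
`{φ μ^{1/k} | φ ∈ L^k(Ω, μ), E_μ(φ) = 0}`. -/
def tangent (k : ℕ) [NeZero k] (μ : ProbabilityMeasure Ω) : Submodule ℝ (RootSpace k Ω) :=
  (meanZero k μ).map (dominated k (toFin μ))

/-- The isomorphism `φ ↦ φ μ^{1/k}` of the mean zero functions in `L^k(Ω, μ)` with the tangent
space. -/
def tangentEquiv (k : ℕ) [NeZero k] (μ : ProbabilityMeasure Ω) :
    meanZero k μ ≃ₗ[ℝ] tangent k μ :=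
  Submodule.equivMapOfInjective (dominated k (toFin μ)) (dominated_injective _) (meanZero k μ)

/-- Distinct probability measures have distinct roots. -/
theorem root_injective (k : ℕ) [NeZero k] :
    Function.Injective (root k : ProbabilityMeasure Ω → RootSpace k Ω) := by
  intro μ ν h
  obtain ⟨ρ, hμ, hν⟩ := exists_ge_ge (toFin μ) (toFin ν)
  unfold root at h
  rw [← dominated_trans hμ, ← dominated_trans hν] at h
  have e := dominated_injective ρ h
  have hk : ((k : ℝ)⁻¹) ≠ 0 := inv_ne_zero (Nat.cast_ne_zero.mpr (NeZero.ne k))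
  have key : (toFin μ).val.rnDeriv ρ.val =ᵐ[ρ.val] (toFin ν).val.rnDeriv ρ.val := by
    filter_upwards [coeFn_trans k hμ ((memLp_const (1 : ℝ)).toLp _),
      coeFn_trans k hν ((memLp_const (1 : ℝ)).toLp _),
      transFun_congr k hμ (MemLp.coeFn_toLp (memLp_const (p := k) (1 : ℝ))),
      transFun_congr k hν (MemLp.coeFn_toLp (memLp_const (p := k) (1 : ℝ))),
      Measure.rnDeriv_lt_top (toFin μ).val ρ.val, Measure.rnDeriv_lt_top (toFin ν).val ρ.val]
      with x h1 h2 h3 h4 h5 h6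
    have h7 := congrArg (fun f : Lp ℝ k ρ.val => f x) e
    simp only [h1, h2, h3, h4] at h7
    simp only [transFun, one_mul] at h7
    rw [Real.rpow_left_inj ENNReal.toReal_nonneg ENNReal.toReal_nonneg hk] at h7
    exact (ENNReal.toReal_eq_toReal_iff' h5.ne h6.ne).mp h7
  have : (toFin μ).val = (toFin ν).val := by
    rw [← Measure.withDensity_rnDeriv_eq _ _ hμ, ← Measure.withDensity_rnDeriv_eq _ _ hν]
    exact withDensity_congr_ae key
  exact Subtype.ext this

end Probability

/-- The set `P^{1/k}(Ω) ⊆ S^{1/k}(Ω)` of roots of probability measures. The root `μ^{1/k}` is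
recorded by `μ`, and the topology is the one of `S^{1/k}(Ω)`. -/
def ProbRoot (_k : ℕ) (Ω : Type u) [MeasurableSpace Ω] : Type u := ProbabilityMeasure Ω

/-- The probability measure `μ` with root `μ^{1/k}`. -/
def ProbRoot.measure {k : ℕ} {Ω : Type u} [MeasurableSpace Ω] (μ : ProbRoot k Ω) :
    ProbabilityMeasure Ω := μ

section TensorFields

variable (k : ℕ) [NeZero k] (Ω : Type u) [MeasurableSpace Ω]

instance : TopologicalSpace (ProbRoot k Ω) :=
  TopologicalSpace.induced (fun μ => root k μ.measure) inferInstance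

/-- A (continuous) vector field on `P^{1/k}(Ω)`. -/
structure VectorField where
  toFun : ProbRoot k Ω → RootSpace k Ω
  continuous_toFun : Continuous toFun
  mem_tangent : ∀ μ, toFun μ ∈ tangent k μ.measure

/-- A covariant `n`-tensor field on `P^{1/k}(Ω)`: an `n`-multilinear form on each tangent space,
such that inserting continuous vector fields always gives a continuous function. -/
structure TensorField (n : ℕ) where
  form : ∀ μ : ProbabilityMeasure Ω, MultilinearMap ℝ (fun _ : Fin n => tangent k μ) ℝ
  continuous_form : ∀ X : Fin n → VectorField k Ω,
    Continuous fun μ : ProbRoot k Ω =>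
      form μ.measure fun j => ⟨(X j).toFun μ, (X j).mem_tangent μ⟩

end TensorFields

section Markov

variable {Ω : Type u} [MeasurableSpace Ω] {Ω' : Type v} [MeasurableSpace Ω']

/-- The Markov morphism `K_* : S(Ω) → S(Ω')` on finite signed measures,
`(K_* s)(A) = ∫ K(ω; A) ds(ω)`, the integral being the difference of the integrals over the
positive and the negative part of `s`. -/
def markovMorphism (K : Kernel Ω Ω') [IsMarkovKernel K] (s : SignedMeasure Ω) :
    SignedMeasure Ω' :=
  (K ∘ₘ s.toJordanDecomposition.posPart).toSignedMeasure -
    (K ∘ₘ s.toJordanDecomposition.negPart).toSignedMeasure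

/-- `K` is congruent if some statistic `κ : Ω' → Ω` satisfies `κ_* K(ω) = δ_ω` for all `ω`. -/
def IsCongruent (K : Kernel Ω Ω') : Prop :=
  ∃ κ : Ω' → Ω, Measurable κ ∧ ∀ ω, (K ω).map κ = Measure.dirac ω

theorem markovMorphism_sub (K : Kernel Ω Ω') [IsMarkovKernel K] (a b : Measure Ω)
    [IsFiniteMeasure a] [IsFiniteMeasure b] :
    markovMorphism K (a.toSignedMeasure - b.toSignedMeasure) =
      (K ∘ₘ a).toSignedMeasure - (K ∘ₘ b).toSignedMeasure := by
  generalize hs : a.toSignedMeasure - b.toSignedMeasure = s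
  have h1 : s.toJordanDecomposition.posPart.toSignedMeasure -
      s.toJordanDecomposition.negPart.toSignedMeasure = s :=
    s.toSignedMeasure_toJordanDecomposition
  have h2 : (s.toJordanDecomposition.posPart + b).toSignedMeasure =
      (a + s.toJordanDecomposition.negPart).toSignedMeasure := by
    rw [Measure.toSignedMeasure_add, Measure.toSignedMeasure_add]
    exact sub_eq_sub_iff_add_eq_add.mp (h1.trans hs.symm)
  have h3 := Measure.toSignedMeasure_eq_toSignedMeasure_iff.mp h2
  have h4 : (K ∘ₘ s.toJordanDecomposition.posPart) + (K ∘ₘ b) =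
      (K ∘ₘ a) + (K ∘ₘ s.toJordanDecomposition.negPart) := by
    rw [← Measure.comp_add, ← Measure.comp_add, h3]
  have h5 := Measure.toSignedMeasure_eq_toSignedMeasure_iff.mpr h4
  rw [Measure.toSignedMeasure_add, Measure.toSignedMeasure_add] at h5
  exact sub_eq_sub_iff_add_eq_add.mpr h5

theorem markovMorphism_withDensity (K : Kernel Ω Ω') [IsMarkovKernel K] (μ : Measure Ω)
    [IsFiniteMeasure μ] {φ : Ω → ℝ} (hm : Measurable φ) (hφ : Integrable φ μ) {A : Set Ω'}
    (hA : MeasurableSet A) :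
    markovMorphism K (μ.withDensityᵥ φ) A = ∫ ω, φ ω * (K ω).real A ∂μ := by
  have fa := isFiniteMeasure_withDensity_ofReal hφ.2
  have fb := isFiniteMeasure_withDensity_ofReal hφ.neg.2
  have hK : Measurable fun ω => K ω A := Kernel.measurable_coe K hA
  have aux : ∀ ψ : Ω → ℝ, Measurable ψ →
      (K ∘ₘ (μ.withDensity fun x => ENNReal.ofReal (ψ x))) A =
        ∫⁻ ω, ENNReal.ofReal (ψ ω * (K ω).real A) ∂μ := by
    intro ψ hψ
    rw [Measure.bind_apply hA K.aemeasurable,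
      lintegral_withDensity_eq_lintegral_mul _ hψ.ennreal_ofReal hK]
    refine lintegral_congr fun ω => ?_
    rw [Pi.mul_apply, mul_comm (ψ ω), ENNReal.ofReal_mul measureReal_nonneg,
      ofReal_measureReal, mul_comm]
  have hint : Integrable (fun ω => φ ω * (K ω).real A) μ := by
    refine hφ.mono (hm.mul hK.ennreal_toReal).aestronglyMeasurable
      (Filter.Eventually.of_forall fun ω => ?_)
    rw [norm_mul, Real.norm_of_nonneg measureReal_nonneg]
    exact mul_le_of_le_one_right (norm_nonneg _) measureReal_le_one
  have e := withDensityᵥ_eq_withDensity_pos_part_sub_withDensity_neg_part hφ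
  rw [e]
  have e2 := markovMorphism_sub K (μ.withDensity fun x => ENNReal.ofReal (φ x))
    (μ.withDensity fun x => ENNReal.ofReal (-φ x))
  rw [e2, integral_eq_lintegral_pos_part_sub_lintegral_neg_part hint, Measure.toSignedMeasure_sub_apply hA]
  simp only [measureReal_def, ← neg_mul]
  rw [aux φ hm, aux (fun x => -φ x) hm.neg]
  rfl

/-- The Radon-Nikodym derivative `d{K_*(φ μ)} / d{K_* μ}`. -/
def kernelDensity (K : Kernel Ω Ω') [IsMarkovKernel K] (μ : Measure Ω) (φ : Ω → ℝ) : Ω' → ℝ :=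
  (markovMorphism K (μ.withDensityᵥ φ)).rnDeriv (K ∘ₘ μ)

theorem withDensity_kernelDensity (K : Kernel Ω Ω') [IsMarkovKernel K] (μ : Measure Ω)
    [IsFiniteMeasure μ] {φ : Ω → ℝ} (hm : Measurable φ) (hφ : Integrable φ μ) :
    (K ∘ₘ μ).withDensityᵥ (kernelDensity K μ φ) = markovMorphism K (μ.withDensityᵥ φ) := by
  apply SignedMeasure.withDensityᵥ_rnDeriv_eq
  refine VectorMeasure.AbsolutelyContinuous.mk fun A hA h => ?_
  rw [Measure.toENNRealVectorMeasure_apply_measurable hA, Measure.bind_apply hA K.aemeasurable,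
    lintegral_eq_zero_iff (Kernel.measurable_coe K hA)] at h
  rw [markovMorphism_withDensity K μ hm hφ hA]
  apply integral_eq_zero_of_ae
  filter_upwards [h] with ω hω
  simp [measureReal_def, hω]

theorem integrable_kernelDensity (K : Kernel Ω Ω') [IsMarkovKernel K] (μ : Measure Ω)
    (φ : Ω → ℝ) : Integrable (kernelDensity K μ φ) (K ∘ₘ μ) :=
  SignedMeasure.integrable_rnDeriv _ _

theorem setIntegral_kernelDensity (K : Kernel Ω Ω') [IsMarkovKernel K] (μ : Measure Ω)
    [IsFiniteMeasure μ] {φ : Ω → ℝ} (hm : Measurable φ) (hφ : Integrable φ μ) {A : Set Ω'}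
    (hA : MeasurableSet A) :
    ∫ y in A, kernelDensity K μ φ y ∂(K ∘ₘ μ) = ∫ ω, φ ω * (K ω).real A ∂μ := by
  rw [← withDensityᵥ_apply (integrable_kernelDensity K μ φ) hA,
    withDensity_kernelDensity K μ hm hφ, markovMorphism_withDensity K μ hm hφ hA]

theorem integrable_mul_kernel (K : Kernel Ω Ω') [IsMarkovKernel K] (μ : Measure Ω)
    {φ : Ω → ℝ} (hφ : Integrable φ μ) {A : Set Ω'} (hA : MeasurableSet A) :
    Integrable (fun ω => φ ω * (K ω).real A) μ := by
  refine hφ.mono (hφ.1.mul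
    (Kernel.measurable_coe K hA).ennreal_toReal.aestronglyMeasurable)
    (Filter.Eventually.of_forall fun ω => ?_)
  rw [norm_mul, Real.norm_of_nonneg measureReal_nonneg]
  exact mul_le_of_le_one_right (norm_nonneg _) measureReal_le_one

theorem memLp_kernelDensity (K : Kernel Ω Ω') [IsMarkovKernel K] (μ : Measure Ω)
    [IsFiniteMeasure μ] {φ : Ω → ℝ} (hm : Measurable φ) {p : ℝ≥0∞} (hp : 1 ≤ p)
    (hφ : MemLp φ p μ) : MemLp (kernelDensity K μ φ) p (K ∘ₘ μ) := by
  have hi : Integrable φ μ := hφ.integrable hp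
  set g := kernelDensity K μ φ with hg
  have gm : Measurable g := SignedMeasure.measurable_rnDeriv _ _
  have gi : Integrable g (K ∘ₘ μ) := SignedMeasure.integrable_rnDeriv _ _
  have hsnd : (μ ⊗ₘ K).map Prod.snd = K ∘ₘ μ := Measure.snd_compProd μ K
  have hfst : (μ ⊗ₘ K).map Prod.fst = μ := Measure.fst_compProd μ K
  have hF : MemLp (fun z : Ω × Ω' => φ z.1) p (μ ⊗ₘ K) := by
    rw [← hfst] at hφ
    exact (memLp_map_measure_iff hm.aestronglyMeasurable measurable_fst.aemeasurable).mp hφ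
  have hFi := hF.integrable hp
  have hGi : Integrable (fun z : Ω × Ω' => g z.2) (μ ⊗ₘ K) := by
    rw [← hsnd] at gi
    exact (integrable_map_measure gm.aestronglyMeasurable measurable_snd.aemeasurable).mp gi
  have hle : MeasurableSpace.comap (Prod.snd : Ω × Ω' → Ω') inferInstance ≤
      (inferInstance : MeasurableSpace (Ω × Ω')) := measurable_snd.comap_le
  have key : (fun z : Ω × Ω' => g z.2) =ᵐ[μ ⊗ₘ K]
      (μ ⊗ₘ K)[fun z => φ z.1 | MeasurableSpace.comap Prod.snd inferInstance] := by
    refine ae_eq_condExp_of_forall_setIntegral_eq hle hFi (fun s _ _ => hGi.integrableOn) ?_ ?_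
    · rintro s ⟨A, hA, rfl⟩ -
      have e1 : ∫ z in Prod.snd ⁻¹' A, g z.2 ∂(μ ⊗ₘ K) = ∫ y in A, g y ∂(K ∘ₘ μ) := by
        rw [← hsnd, setIntegral_map hA gm.aestronglyMeasurable measurable_snd.aemeasurable]
      have e2 : ∫ z in Prod.snd ⁻¹' A, φ z.1 ∂(μ ⊗ₘ K) = ∫ ω, φ ω * (K ω).real A ∂μ := by
        rw [← Set.univ_prod, Measure.setIntegral_compProd MeasurableSet.univ hA hFi.integrableOn]
        simp [mul_comm]
      rw [e1, e2, ← withDensityᵥ_apply gi hA, hg, withDensity_kernelDensity K μ hm hi,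
        markovMorphism_withDensity K μ hm hi hA]
    · exact (gm.comp (comap_measurable _)).aestronglyMeasurable
  have hG : MemLp (fun z : Ω × Ω' => g z.2) p (μ ⊗ₘ K) :=
    (memLp_congr_ae key).mpr (hF.condExp hp)
  rw [← hsnd]
  exact (memLp_map_measure_iff gm.aestronglyMeasurable measurable_snd.aemeasurable).mpr hG

/-- The image `K_* μ` of a probability measure. -/
def push (K : Kernel Ω Ω') [IsMarkovKernel K] (μ : ProbabilityMeasure Ω) :
    ProbabilityMeasure Ω' := ⟨K ∘ₘ (μ : Measure Ω), inferInstance⟩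

variable {k : ℕ} [NeZero k]

theorem integrable_coe {μ : FinMeasure Ω} (φ : Lp ℝ k μ.val) : Integrable φ μ.val :=
  (Lp.memLp φ).integrable Fact.out

theorem memLp_kernelDensity_coe (K : Kernel Ω Ω') [IsMarkovKernel K] (μ : ProbabilityMeasure Ω)
    (φ : Lp ℝ k (toFin μ).val) :
    MemLp (kernelDensity K (toFin μ).val φ) k (toFin (push K μ)).val :=
  memLp_kernelDensity K (toFin μ).val (Lp.stronglyMeasurable φ).measurable Fact.out (Lp.memLp φ)

/-- The map `L^k(Ω, μ) → L^k(Ω', K_* μ)`, `φ ↦ d{K_*(φ μ)} / d{K_* μ}`. -/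
def densityMap (K : Kernel Ω Ω') [IsMarkovKernel K] (μ : ProbabilityMeasure Ω) :
    Lp ℝ k (toFin μ).val →ₗ[ℝ] Lp ℝ k (toFin (push K μ)).val where
  toFun φ := (memLp_kernelDensity_coe K μ φ).toLp _
  map_add' φ ψ := by
    rw [← MemLp.toLp_add]
    apply MemLp.toLp_congr
    have hi := fun φ : Lp ℝ k (toFin μ).val => integrable_kernelDensity K (toFin μ).val φ
    refine Integrable.ae_eq_of_forall_setIntegral_eq _ _ (hi _) ((hi _).add (hi _))
      fun A hA _ => ?_
    have hS := fun φ : Lp ℝ k (toFin μ).val => setIntegral_kernelDensity K (toFin μ).val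
      (Lp.stronglyMeasurable φ).measurable (integrable_coe φ) hA
    have hM := fun φ : Lp ℝ k (toFin μ).val =>
      integrable_mul_kernel K (toFin μ).val (integrable_coe φ) hA
    have e2 : ∫ y in A, (kernelDensity K (toFin μ).val φ + kernelDensity K (toFin μ).val ψ) y
        ∂(K ∘ₘ (toFin μ).val) = _ := integral_add (hi φ).integrableOn (hi ψ).integrableOn
    refine (hS _).trans (Eq.trans ?_ e2.symm)
    rw [hS, hS, ← integral_add (hM φ) (hM ψ)]
    apply integral_congr_ae
    filter_upwards [Lp.coeFn_add φ ψ] with ω hω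
    rw [hω, Pi.add_apply, add_mul]
  map_smul' c φ := by
    rw [RingHom.id_apply, ← MemLp.toLp_const_smul]
    apply MemLp.toLp_congr
    have hi := fun φ : Lp ℝ k (toFin μ).val => integrable_kernelDensity K (toFin μ).val φ
    refine Integrable.ae_eq_of_forall_setIntegral_eq _ _ (hi _) ((hi _).smul c)
      fun A hA _ => ?_
    have hS := fun φ : Lp ℝ k (toFin μ).val => setIntegral_kernelDensity K (toFin μ).val
      (Lp.stronglyMeasurable φ).measurable (integrable_coe φ) hA
    have e2 : ∫ y in A, (c • kernelDensity K (toFin μ).val φ) y ∂(K ∘ₘ (toFin μ).val) = _ :=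
      integral_smul c _
    refine (hS _).trans (Eq.trans ?_ e2.symm)
    rw [hS, smul_eq_mul, ← integral_const_mul]
    apply integral_congr_ae
    filter_upwards [Lp.coeFn_smul c φ] with ω hω
    rw [hω, Pi.smul_apply, smul_eq_mul, mul_assoc]

theorem densityMap_mem (K : Kernel Ω Ω') [IsMarkovKernel K] (μ : ProbabilityMeasure Ω)
    (φ : Lp ℝ k (toFin μ).val) (hφ : φ ∈ meanZero k μ) :
    densityMap K μ φ ∈ meanZero k (push K μ) := by
  have e := integral_congr_ae (MemLp.coeFn_toLp (memLp_kernelDensity_coe K μ φ))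
  have h := setIntegral_kernelDensity K (toFin μ).val
    (Lp.stronglyMeasurable φ).measurable (integrable_coe φ) MeasurableSet.univ
  simp only [Measure.restrict_univ, probReal_univ, mul_one] at h
  exact e.trans (h.trans hφ)

/-- The formal derivative `d_{μ^{1/k}} K_{1/k}` of `K_{1/k}` on the tangent space of `P^{1/k}(Ω)`:
`φ μ^{1/k} ↦ (d{K_*(φ μ)} / d{K_* μ}) (K_* μ)^{1/k}`. -/
def formalDeriv (k : ℕ) [NeZero k] (K : Kernel Ω Ω') [IsMarkovKernel K]
    (μ : ProbabilityMeasure Ω) : tangent k μ →ₗ[ℝ] tangent k (push K μ) :=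
  (tangentEquiv k (push K μ)).toLinearMap ∘ₗ
    ((densityMap K μ).restrict (densityMap_mem K μ)) ∘ₗ (tangentEquiv k μ).symm.toLinearMap

/-- The pullback `K_{1/k}^* Ψ` of a tensor field on `P^{1/k}(Ω')`, a multilinear form on each
tangent space of `P^{1/k}(Ω)`. -/
def markovPullback {n : ℕ} (K : Kernel Ω Ω') [IsMarkovKernel K] (Ψ : TensorField k Ω' n)
    (μ : ProbabilityMeasure Ω) : MultilinearMap ℝ (fun _ : Fin n => tangent k μ) ℝ :=
  (Ψ.form (push K μ)).compLinearMap fun _ => formalDeriv k K μ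

end Markov

section Canonical

/-- The canonical `n`-tensor `L^n(ν_1, …, ν_n) = n^n ∫ d(ν_1 ⋯ ν_n)` on `S^{1/n}(Ω)`. If
`ν_i = φ_i μ^{1/n}` for a finite measure `μ`, then `ν_1 ⋯ ν_n = φ_1 ⋯ φ_n μ`; the value does not
depend on the choice of `μ`, see `canonicalForm_dominated`. -/
def canonicalForm {Ω : Type u} [MeasurableSpace Ω] (n : ℕ) [NeZero n]
    (ν : Fin n → RootSpace n Ω) : ℝ :=
  (n : ℝ) ^ n * ∫ x, ∏ i, (exists_dominated_family ν).choose_spec.choose i x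
    ∂(exists_dominated_family ν).choose.val

theorem integral_prod_trans {Ω : Type u} [MeasurableSpace Ω] {n : ℕ} [NeZero n]
    {μ ρ : FinMeasure Ω} (h : μ ≤ ρ) (φ : Fin n → Lp ℝ n μ.val) :
    ∫ x, ∏ i, (trans n μ ρ h (φ i)) x ∂ρ.val = ∫ x, ∏ i, φ i x ∂μ.val := by
  rw [← integral_rnDeriv_smul h]
  apply integral_congr_ae
  have hall : ∀ᵐ x ∂ρ.val, ∀ i, (trans n μ ρ h (φ i)) x = transFun n μ.val ρ.val (φ i) x :=
    ae_all_iff.mpr fun i => coeFn_trans n h (φ i)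
  filter_upwards [hall] with x hx
  simp only [hx, transFun, Finset.prod_mul_distrib, Finset.prod_const, Finset.card_univ,
    Fintype.card_fin, smul_eq_mul]
  rw [← Real.rpow_natCast, ← Real.rpow_mul ENNReal.toReal_nonneg,
    inv_mul_cancel₀ (Nat.cast_ne_zero.mpr (NeZero.ne n)), Real.rpow_one, mul_comm]

theorem canonicalForm_dominated {Ω : Type u} [MeasurableSpace Ω] {n : ℕ} [NeZero n]
    (μ : FinMeasure Ω) (φ : Fin n → Lp ℝ n μ.val) :
    canonicalForm n (fun i => dominated n μ (φ i)) = (n : ℝ) ^ n * ∫ x, ∏ i, φ i x ∂μ.val := by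
  have hs := (exists_dominated_family fun i => dominated n μ (φ i)).choose_spec.choose_spec
  unfold canonicalForm
  set σ := (exists_dominated_family fun i => dominated n μ (φ i)).choose
  set ψ := (exists_dominated_family fun i => dominated n μ (φ i)).choose_spec.choose
  obtain ⟨ρ, h1, h2⟩ := exists_ge_ge σ μ
  rw [← integral_prod_trans h1 ψ, ← integral_prod_trans h2 φ]
  have e : ∀ i, trans n _ _ h1 (ψ i) = trans n _ _ h2 (φ i) := fun i => by
    apply dominated_injective ρ
    rw [dominated_trans, dominated_trans]
    exact (hs i).symm
  simp only [e]

/-- The Fisher metric on `P^{1/2}(Ω)`, `g_μ(φ_1 μ^{1/2}, φ_2 μ^{1/2}) = 4 ∫ φ_1 φ_2 dμ`. -/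
def fisherMetric {Ω : Type u} [MeasurableSpace Ω] (μ : ProbabilityMeasure Ω)
    (V : Fin 2 → tangent 2 μ) : ℝ :=
  canonicalForm 2 fun j => (V j : RootSpace 2 Ω)

/-- The Amari-Chentsov tensor on `P^{1/3}(Ω)`,
`T_μ(φ_1 μ^{1/3}, φ_2 μ^{1/3}, φ_3 μ^{1/3}) = 27 ∫ φ_1 φ_2 φ_3 dμ`. -/
def amariChentsov {Ω : Type u} [MeasurableSpace Ω] (μ : ProbabilityMeasure Ω)
    (V : Fin 3 → tangent 3 μ) : ℝ :=
  canonicalForm 3 fun j => (V j : RootSpace 3 Ω)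

end Canonical

/-- A congruent family of `n`-tensors on the spaces `P^{1/k}(Ω)`. -/
def IsCongruentFamily {k : ℕ} [NeZero k] {n : ℕ}
    (Θ : ∀ (Ω : Type u) [MeasurableSpace Ω], TensorField k Ω n) : Prop :=
  ∀ (Ω Ω' : Type u) [MeasurableSpace Ω] [MeasurableSpace Ω'] (K : Kernel Ω Ω') [IsMarkovKernel K],
    IsCongruent K → ∀ μ : ProbabilityMeasure Ω, markovPullback K (Θ Ω') μ = (Θ Ω).form μ

section Models

variable {Ω : Type u} [MeasurableSpace Ω]
  {E : Type*} [NormedAddCommGroup E] [NormedSpace ℝ E] {H : Type*} [TopologicalSpace H]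
  (I : ModelWithCorners ℝ E H) {M : Type*} [TopologicalSpace M] [ChartedSpace H M]

/-- A `k`-integrable statistical model: `p : M → P(Ω)` is Fréchet differentiable as a map into
`S(Ω) = S^{1/1}(Ω)`, and `p^{1/k}` is Fréchet differentiable as a map into `S^{1/k}(Ω)`. -/
structure IsIntegrableModel (k : ℕ) [NeZero k] (p : M → ProbabilityMeasure Ω) : Prop where
  mdifferentiable : MDifferentiable I 𝓘(ℝ, RootSpace 1 Ω) fun ξ => root 1 (p ξ)
  mdifferentiable_root : MDifferentiable I 𝓘(ℝ, RootSpace k Ω) fun ξ => root k (p ξ)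

/-- The differential `d_ξ p^{1/k} : T_ξ M → S^{1/k}(Ω)`. -/
def rootDeriv (k : ℕ) [NeZero k] (p : M → ProbabilityMeasure Ω) (ξ : M) :
    TangentSpace I ξ →ₗ[ℝ] RootSpace k Ω :=
  (mfderiv I 𝓘(ℝ, RootSpace k Ω) (fun η => root k (p η)) ξ).toLinearMap

/-- The pullback `(p^{1/k})^* Ψ` of a tensor field on `P^{1/k}(Ω)`, for `p^{1/k}` with differentials
tangent to `P^{1/k}(Ω)`. -/
def modelPullback {k : ℕ} [NeZero k] {n : ℕ} (p : M → ProbabilityMeasure Ω)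
    (h : ∀ ξ v, rootDeriv I k p ξ v ∈ tangent k (p ξ)) (Ψ : TensorField k Ω n) (ξ : M) :
    MultilinearMap ℝ (fun _ : Fin n => TangentSpace I ξ) ℝ :=
  (Ψ.form (p ξ)).compLinearMap fun _ => (rootDeriv I k p ξ).codRestrict _ (h ξ)

/-- The canonical `n`-tensor `(p^{1/n})^* L^n` of a model. For `n = 2` it is the Fisher metric of
the model, for `n = 3` the Amari-Chentsov tensor of the model. -/
def modelTensor (n : ℕ) [NeZero n] (p : M → ProbabilityMeasure Ω) (ξ : M)
    (v : Fin n → TangentSpace I ξ) : ℝ :=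
  canonicalForm n fun j => rootDeriv I n p ξ (v j)

end Models

end RootMeasure

end

/-!
Congruence under the conditional distributions of a measure on the fibres of a statistic relates a
space to a finite quotient of it, and congruence applies to permutations as well. On a uniformly
distributed finite set `J` the tensor is thus invariant under permutations, which for two or three
mean-zero arguments `f i` leaves only multiples of `∑ j, ∏ i, f i j`. The factor does not depend on
`J`: it agrees with that of a three-element set `B` through the uniform distribution on `J × B`.
Weights `(m j / ∑ i, m i)` are images of uniform distributions under maps with fibres of `m j`
points, and every weight is a limit of these. Finally, a finite family of simple functions on any
`Ω` factors through a finite set, which settles all tangent vectors given by simple functions.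

The forms are only assumed to be continuous along vector fields, so the density of simple functions
in `L^n(Ω, μ)` does not suffice. Instead an arbitrary tangent vector at `μ` is the value of a vector
field whose values at all other points are given by simple functions, and `μ` is a limit of such
points.

The differential of a model is annihilated by every continuous functional that is extremal on
`P^{1/n}(Ω)` at `p(ξ)^{1/n}`. Integration over a `p(ξ)`-null set is such a functional, which makes
the differential dominated by `p(ξ)`, and the integral against `p(ξ)` is another.
-/

noncomputable section

namespace RootMeasure

section CanonicalForm

variable {Ω : Type u} [MeasurableSpace Ω] {n : ℕ}

theorem prod_update_apply {μ : Measure Ω} (φ : Fin n → Lp ℝ n μ) (i : Fin n) (ψ : Lp ℝ n μ)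
    (x : Ω) : ∏ j, Function.update φ i ψ j x = ψ x * ∏ j ∈ Finset.univ \ {i}, φ j x := by
  simp only [Function.apply_update (fun _ (χ : Lp ℝ n μ) => χ x)]
  exact Finset.prod_update_of_mem (Finset.mem_univ i) _ _

variable [NeZero n]

theorem memLp_one_prod {μ : Measure Ω} {φ : Fin n → Ω → ℝ} (hφ : ∀ i, MemLp (φ i) n μ) :
    MemLp (fun x => ∏ i, φ i x) 1 μ := by
  have h := MemLp.prod' (s := Finset.univ) (p := fun _ => (n : ℝ≥0∞)) fun i _ => hφ i
  have e : (∑ _i : Fin n, ((n : ℝ≥0∞))⁻¹)⁻¹ = 1 := by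
    rw [Finset.sum_const, Finset.card_univ, Fintype.card_fin, nsmul_eq_mul,
      ENNReal.mul_inv_cancel (by exact_mod_cast NeZero.ne n) (ENNReal.natCast_ne_top n), inv_one]
  rwa [e] at h

theorem integrable_prod_coe {μ : Measure Ω} (φ : Fin n → Lp ℝ n μ) :
    Integrable (fun x => ∏ i, φ i x) μ :=
  memLp_one_iff_integrable.mp (memLp_one_prod fun i => Lp.memLp (φ i))

theorem lintegral_prod_enorm_le {μ : Measure Ω} (φ : Fin n → Lp ℝ n μ) :
    ∫⁻ x, ∏ i, ‖φ i x‖ₑ ∂μ ≤ ∏ i, ‖φ i‖ₑ := by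
  have hn : (n : ℝ) ≠ 0 := Nat.cast_ne_zero.mpr (NeZero.ne n)
  have hn' : (n : ℝ≥0∞) ≠ 0 := by exact_mod_cast NeZero.ne n
  have holder := ENNReal.lintegral_prod_norm_pow_le (μ := μ) (Finset.univ : Finset (Fin n))
    (f := fun i x => ‖φ i x‖ₑ ^ (n : ℝ)) (p := fun _ => (n : ℝ)⁻¹)
    (fun i _ => ((Lp.stronglyMeasurable (φ i)).measurable.enorm.pow_const _).aemeasurable)
    (by simp [hn]) (fun _ _ => by positivity)
  have e : ∀ i, (∫⁻ x, ‖φ i x‖ₑ ^ (n : ℝ) ∂μ) ^ ((n : ℝ)⁻¹) = ‖φ i‖ₑ := fun i => by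
    rw [Lp.enorm_def, eLpNorm_eq_lintegral_rpow_enorm_toReal hn' (ENNReal.natCast_ne_top n)]
    simp
  simpa only [e, ← ENNReal.rpow_mul, mul_inv_cancel₀ hn, ENNReal.rpow_one] using holder

theorem norm_integral_prod_le {μ : Measure Ω} (φ : Fin n → Lp ℝ n μ) :
    ‖∫ x, ∏ i, φ i x ∂μ‖ ≤ ∏ i, ‖φ i‖ := by
  have h : ‖∫ x, ∏ i, φ i x ∂μ‖ₑ ≤ ∏ i, ‖φ i‖ₑ := by
    refine (enorm_integral_le_lintegral_enorm _).trans (le_trans (le_of_eq ?_)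
      (lintegral_prod_enorm_le φ))
    simp only [enorm_eq_nnnorm, nnnorm_prod, ENNReal.ofNNReal_finsetProd]
  have h' := ENNReal.toReal_mono (ENNReal.prod_ne_top fun _ _ => enorm_ne_top) h
  simpa only [ENNReal.toReal_prod, toReal_enorm] using h'

theorem canonicalForm_update_dominated (μ : FinMeasure Ω) (φ : Fin n → Lp ℝ n μ.val) (i : Fin n)
    (ψ : Lp ℝ n μ.val) :
    canonicalForm n (Function.update (fun j => dominated n μ (φ j)) i (dominated n μ ψ)) =
      (n : ℝ) ^ n * ∫ x, ψ x * ∏ j ∈ Finset.univ \ {i}, φ j x ∂μ.val := by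
  rw [← funext (Function.apply_update (fun _ => dominated n μ) φ i ψ), canonicalForm_dominated]
  simp only [prod_update_apply]

theorem integrable_mul_prod_coe {μ : Measure Ω} (φ : Fin n → Lp ℝ n μ) (i : Fin n)
    (ψ : Lp ℝ n μ) : Integrable (fun x => ψ x * ∏ j ∈ Finset.univ \ {i}, φ j x) μ := by
  simpa only [prod_update_apply] using integrable_prod_coe (Function.update φ i ψ)

theorem canonicalForm_update_add (v : Fin n → RootSpace n Ω) (i : Fin n) (x y : RootSpace n Ω) :
    canonicalForm n (Function.update v i (x + y)) =
      canonicalForm n (Function.update v i x) + canonicalForm n (Function.update v i y) := by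
  obtain ⟨μ, φ, hφ⟩ :=
    exists_dominated_family (Fin.cons x (Fin.cons y v) : Fin (n + 1 + 1) → RootSpace n Ω)
  obtain rfl : x = dominated n μ (φ 0) := hφ 0
  obtain rfl : y = dominated n μ (φ 1) := hφ 1
  obtain rfl : v = fun j => dominated n μ (φ j.succ.succ) := funext fun j => hφ j.succ.succ
  rw [← map_add, canonicalForm_update_dominated, canonicalForm_update_dominated,
    canonicalForm_update_dominated, ← mul_add,
    ← integral_add (integrable_mul_prod_coe _ _ _) (integrable_mul_prod_coe _ _ _)]
  congr 1
  refine integral_congr_ae ?_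
  filter_upwards [Lp.coeFn_add (φ 0) (φ 1)] with a ha
  rw [ha, Pi.add_apply, add_mul]

theorem canonicalForm_update_smul (v : Fin n → RootSpace n Ω) (i : Fin n) (c : ℝ)
    (x : RootSpace n Ω) :
    canonicalForm n (Function.update v i (c • x)) =
      c • canonicalForm n (Function.update v i x) := by
  obtain ⟨μ, φ, hφ⟩ := exists_dominated_family (Fin.cons x v : Fin (n + 1) → RootSpace n Ω)
  obtain rfl : x = dominated n μ (φ 0) := hφ 0
  obtain rfl : v = fun j => dominated n μ (φ j.succ) := funext fun j => hφ j.succ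
  rw [← map_smul (dominated n μ), canonicalForm_update_dominated, canonicalForm_update_dominated,
    smul_eq_mul, mul_left_comm, ← integral_const_mul c]
  congr 1
  refine integral_congr_ae ?_
  filter_upwards [Lp.coeFn_smul c (φ 0)] with a ha
  rw [ha, Pi.smul_apply, smul_eq_mul, mul_assoc]

theorem norm_canonicalForm_le (v : Fin n → RootSpace n Ω) :
    ‖canonicalForm n v‖ ≤ (n : ℝ) ^ n * ∏ i, ‖v i‖ := by
  obtain ⟨μ, φ, hφ⟩ := exists_dominated_family v
  obtain rfl : v = fun j => dominated n μ (φ j) := funext hφ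
  rw [canonicalForm_dominated, norm_mul, Real.norm_of_nonneg (by positivity)]
  exact mul_le_mul_of_nonneg_left (norm_integral_prod_le φ) (by positivity)

variable (n Ω) in
/-- The canonical `n`-tensor `L^n` as a continuous multilinear form on `S^{1/n}(Ω)`. -/
def canonicalMultilinear : ContinuousMultilinearMap ℝ (fun _ : Fin n => RootSpace n Ω) ℝ :=
  MultilinearMap.mkContinuous
    { toFun := canonicalForm n
      map_update_add' := by
        intro inst v i x y
        rw [Subsingleton.elim inst (instDecidableEqFin n)]
        exact canonicalForm_update_add v i x y
      map_update_smul' := by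
        intro inst v i c x
        rw [Subsingleton.elim inst (instDecidableEqFin n)]
        exact canonicalForm_update_smul v i c x }
    ((n : ℝ) ^ n) norm_canonicalForm_le

theorem continuous_canonicalForm : Continuous (canonicalForm (Ω := Ω) n) :=
  (canonicalMultilinear Ω n).cont

end CanonicalForm

section Roots

variable {Ω : Type u} [MeasurableSpace Ω] {n : ℕ} [NeZero n]

theorem isometry_dominated (μ : FinMeasure Ω) : Isometry (dominated n μ) :=
  AddMonoidHomClass.isometry_of_norm _ (norm_dominated μ)

/-- `P^{1/n}(Ω)` with the metric induced from `S^{1/n}(Ω)`. -/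
instance : MetricSpace (ProbRoot n Ω) :=
  MetricSpace.induced (fun μ => root n μ.measure) (root_injective n) inferInstance

theorem isometry_root : Isometry fun μ : ProbRoot n Ω => root n μ.measure := fun _ _ => rfl

theorem root_eq_dominated_of_withDensity (ν : ProbabilityMeasure Ω) (μ : FinMeasure Ω)
    {g : Ω → ℝ} (hm : Measurable g) (h0 : ∀ x, 0 ≤ g x)
    (hν : (ν : Measure Ω) = μ.val.withDensity fun x => ENNReal.ofReal (g x ^ n))
    (hg : MemLp g n μ.val) : root n ν = dominated n μ (hg.toLp g) := by
  have hn : (n : ℝ) ≠ 0 := Nat.cast_ne_zero.mpr (NeZero.ne n)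
  have hle : toFin ν ≤ μ := by
    change (ν : Measure Ω) ≪ μ.val
    exact hν ▸ withDensity_absolutelyContinuous _ _
  have hrn : (ν : Measure Ω).rnDeriv μ.val =ᵐ[μ.val] fun x => ENNReal.ofReal (g x ^ n) := by
    rw [hν]
    exact Measure.rnDeriv_withDensity μ.val (hm.pow_const n).ennreal_ofReal
  rw [root, ← dominated_trans hle]
  congr 1
  apply Lp.ext
  filter_upwards [coeFn_trans n hle ((memLp_const (1 : ℝ)).toLp _),
    transFun_congr n hle (MemLp.coeFn_toLp (memLp_const (p := n) (1 : ℝ))), hg.coeFn_toLp, hrn]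
    with x h1 h2 h3 h4
  rw [h1, h2, h3]
  change 1 * ((ν : Measure Ω).rnDeriv μ.val x).toReal ^ ((n : ℝ)⁻¹) = g x
  rw [h4, ENNReal.toReal_ofReal (pow_nonneg (h0 x) n), one_mul, ← Real.rpow_natCast,
    ← Real.rpow_mul (h0 x), mul_inv_cancel₀ hn, Real.rpow_one]

variable (n) in
/-- The integral against `μ`, `φ μ^{1/n} ↦ ∫ φ dμ`, as a functional on all of `S^{1/n}(Ω)`: up to
the factor `n^n` it is `x ↦ L^n(x, μ^{1/n}, …, μ^{1/n})`. -/
def meanAt (μ : ProbabilityMeasure Ω) : RootSpace n Ω →L[ℝ] ℝ :=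
  ((n : ℝ) ^ n)⁻¹ • (canonicalMultilinear Ω n).toContinuousLinearMap (fun _ => root n μ) 0

theorem meanAt_apply (μ : ProbabilityMeasure Ω) (x : RootSpace n Ω) :
    meanAt n μ x =
      ((n : ℝ) ^ n)⁻¹ * canonicalForm n (Function.update (fun _ => root n μ) 0 x) := rfl

theorem meanAt_dominated (μ : ProbabilityMeasure Ω) (φ : Lp ℝ n (toFin μ).val) :
    meanAt n μ (dominated n (toFin μ) φ) = ∫ x, φ x ∂(toFin μ).val := by
  have hn : (n : ℝ) ^ n ≠ 0 := pow_ne_zero _ (Nat.cast_ne_zero.mpr (NeZero.ne n))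
  rw [meanAt_apply]
  unfold root
  rw [canonicalForm_update_dominated, inv_mul_cancel_left₀ hn]
  refine integral_congr_ae ?_
  filter_upwards [MemLp.coeFn_toLp (memLp_const (p := n) (μ := (toFin μ).val) (1 : ℝ))] with x hx
  simp only [hx, Finset.prod_const_one, mul_one]

theorem meanAt_root (μ : ProbabilityMeasure Ω) : meanAt n μ (root n μ) = 1 := by
  rw [root, meanAt_dominated, integral_congr_ae (MemLp.coeFn_toLp _)]
  simp

theorem mem_tangent_iff {μ : ProbabilityMeasure Ω} {x : RootSpace n Ω} :
    x ∈ tangent n μ ↔ x ∈ LinearMap.range (dominated n (toFin μ)) ∧ meanAt n μ x = 0 := by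
  constructor
  · rintro ⟨φ, hφ, rfl⟩
    exact ⟨⟨φ, rfl⟩, (meanAt_dominated μ φ).trans hφ⟩
  · rintro ⟨⟨φ, rfl⟩, hφ⟩
    exact ⟨φ, (meanAt_dominated μ φ).symm.trans hφ, rfl⟩

theorem continuous_meanAt {X : Type*} [TopologicalSpace X] {p : X → ProbRoot n Ω}
    (hp : Continuous p) {F : X → RootSpace n Ω} (hF : Continuous F) :
    Continuous fun t => meanAt n (p t).measure (F t) :=
  continuous_const.mul (continuous_canonicalForm.comp
    ((continuous_pi fun _ => isometry_root.continuous.comp hp).update 0 hF))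

variable (n) in
/-- The projection `x ↦ x - E_μ(x) μ^{1/n}` of `S^{1/n}(Ω)` onto the kernel of `meanAt n μ`. -/
def center (μ : ProbabilityMeasure Ω) : RootSpace n Ω →L[ℝ] RootSpace n Ω :=
  ContinuousLinearMap.id ℝ _ - (meanAt n μ).smulRight (root n μ)

theorem center_apply (μ : ProbabilityMeasure Ω) (x : RootSpace n Ω) :
    center n μ x = x - meanAt n μ x • root n μ := rfl

theorem center_dominated_mem_tangent (μ : ProbabilityMeasure Ω) (φ : Lp ℝ n (toFin μ).val) :
    center n μ (dominated n (toFin μ) φ) ∈ tangent n μ := by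
  rw [mem_tangent_iff, center_apply, map_sub, map_smul, meanAt_root, smul_eq_mul, mul_one, sub_self]
  exact ⟨Submodule.sub_mem _ ⟨φ, rfl⟩ (Submodule.smul_mem _ _ ⟨_, rfl⟩), rfl⟩

theorem center_eq_self {μ : ProbabilityMeasure Ω} {x : RootSpace n Ω} (hx : x ∈ tangent n μ) :
    center n μ x = x := by
  rw [center_apply, (mem_tangent_iff.mp hx).2, zero_smul, sub_zero]

end Roots

section SimpleFunctions

variable {Ω : Type u} [MeasurableSpace Ω] {n : ℕ} [NeZero n]

/-- The class in `L^n(Ω, μ)` of a simple function. -/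
def simpleLp (n : ℕ) (μ : FinMeasure Ω) : SimpleFunc Ω ℝ →ₗ[ℝ] Lp ℝ n μ.val where
  toFun s := (s.memLp_of_isFiniteMeasure n μ.val).toLp s
  map_add' _ _ := rfl
  map_smul' _ _ := rfl

theorem coeFn_simpleLp {n : ℕ} (μ : FinMeasure Ω) (s : SimpleFunc Ω ℝ) :
    simpleLp n μ s =ᵐ[μ.val] s :=
  MemLp.coeFn_toLp (s.memLp_of_isFiniteMeasure n μ.val)

theorem denseRange_simpleLp (μ : FinMeasure Ω) : DenseRange (simpleLp n μ) := by
  refine (Lp.simpleFunc.denseRange (ENNReal.natCast_ne_top n)).mono ?_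
  rintro _ ⟨g, rfl⟩
  exact ⟨Lp.simpleFunc.toSimpleFunc g,
    congrArg Subtype.val (Lp.simpleFunc.toLp_toSimpleFunc g)⟩

variable (n) in
/-- The element `s μ^{1/n}` of `S^{1/n}(Ω)`, for a simple function `s`. -/
def simpleRoot (μ : FinMeasure Ω) : SimpleFunc Ω ℝ →ₗ[ℝ] RootSpace n Ω :=
  dominated n μ ∘ₗ simpleLp n μ

theorem simpleRoot_one (μ : ProbabilityMeasure Ω) : simpleRoot n (toFin μ) 1 = root n μ := rfl

theorem simpleRoot_const (μ : ProbabilityMeasure Ω) (c : ℝ) :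
    simpleRoot n (toFin μ) (SimpleFunc.const Ω c) = c • root n μ := by
  rw [← simpleRoot_one, ← map_smul]
  congr 1
  ext x
  simp

theorem meanAt_simpleRoot (μ : ProbabilityMeasure Ω) (s : SimpleFunc Ω ℝ) :
    meanAt n μ (simpleRoot n (toFin μ) s) = ∫ x, s x ∂(μ : Measure Ω) :=
  (meanAt_dominated μ _).trans (integral_congr_ae (coeFn_simpleLp (toFin μ) s))

theorem coeFn_trans_simpleLp {μ ρ : FinMeasure Ω} (h : μ ≤ ρ) (s : SimpleFunc Ω ℝ) :
    trans n μ ρ h (simpleLp n μ s) =ᵐ[ρ.val] transFun n μ.val ρ.val s :=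
  (coeFn_trans n h _).trans (transFun_congr n h (coeFn_simpleLp μ s))

theorem norm_simpleRoot_sub_le (s : SimpleFunc Ω ℝ) {C : ℝ} (hC : ∀ x, ‖s x‖ ≤ C)
    (μ ν : FinMeasure Ω) :
    ‖simpleRoot n μ s - simpleRoot n ν s‖ ≤ C * ‖simpleRoot n μ 1 - simpleRoot n ν 1‖ := by
  obtain ⟨ρ, hμ, hν⟩ := exists_ge_ge μ ν
  have norm_eq : ∀ t : SimpleFunc Ω ℝ, ‖simpleRoot n μ t - simpleRoot n ν t‖ =
      ‖trans n _ _ hμ (simpleLp n μ t) - trans n _ _ hν (simpleLp n ν t)‖ := fun t => by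
    rw [← norm_dominated, map_sub, dominated_trans, dominated_trans]
    rfl
  rw [norm_eq, norm_eq]
  apply Lp.norm_le_mul_norm_of_ae_le_mul
  filter_upwards [coeFn_trans_simpleLp (n := n) hμ s, coeFn_trans_simpleLp (n := n) hν s,
    coeFn_trans_simpleLp (n := n) hμ 1, coeFn_trans_simpleLp (n := n) hν 1,
    Lp.coeFn_sub (trans n _ _ hμ (simpleLp n _ s)) (trans n _ _ hν (simpleLp n _ s)),
    Lp.coeFn_sub (trans n _ _ hμ (simpleLp n _ 1)) (trans n _ _ hν (simpleLp n _ 1))]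
    with x hμs hνs hμ1 hν1 hs h1
  simp only [hs, h1, Pi.sub_apply, hμs, hνs, hμ1, hν1, transFun, SimpleFunc.coe_one, Pi.one_apply,
    one_mul]
  rw [← mul_sub, norm_mul]
  exact mul_le_mul_of_nonneg_right (hC x) (norm_nonneg _)

theorem continuous_simpleRoot (s : SimpleFunc Ω ℝ) :
    Continuous fun μ : ProbRoot n Ω => simpleRoot n (toFin μ.measure) s := by
  obtain ⟨C, hC⟩ := s.exists_forall_norm_le
  refine (LipschitzWith.of_dist_le_mul (K := C.toNNReal) fun μ ν => ?_).continuous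
  rw [dist_eq_norm]
  refine (norm_simpleRoot_sub_le s (fun x => (hC x).trans (Real.le_coe_toNNReal C)) _ _).trans
    (le_of_eq ?_)
  rw [← dist_eq_norm]
  rfl

variable (n) in
/-- The tangent vector `(s - E_μ(s)) μ^{1/n}` of a simple function `s`. -/
def simpleTangent (μ : ProbabilityMeasure Ω) : SimpleFunc Ω ℝ →ₗ[ℝ] tangent n μ :=
  ((center n μ).toLinearMap ∘ₗ simpleRoot n (toFin μ)).codRestrict (tangent n μ)
    fun s => center_dominated_mem_tangent μ (simpleLp n _ s)

theorem coe_simpleTangent (μ : ProbabilityMeasure Ω) (s : SimpleFunc Ω ℝ) :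
    (simpleTangent n μ s : RootSpace n Ω) = center n μ (simpleRoot n (toFin μ) s) := rfl

theorem coe_simpleTangent_eq_simpleRoot (μ : ProbabilityMeasure Ω) (s : SimpleFunc Ω ℝ) :
    (simpleTangent n μ s : RootSpace n Ω) =
      simpleRoot n (toFin μ) (s - SimpleFunc.const Ω (∫ x, s x ∂(μ : Measure Ω))) := by
  rw [coe_simpleTangent, center_apply, meanAt_simpleRoot, map_sub, simpleRoot_const]

theorem simpleTangent_const (μ : ProbabilityMeasure Ω) (c : ℝ) :
    simpleTangent n μ (SimpleFunc.const Ω c) = 0 := by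
  apply Subtype.ext
  rw [coe_simpleTangent, simpleRoot_const, map_smul, center_apply, meanAt_root, one_smul, sub_self,
    smul_zero, Submodule.coe_zero]

theorem continuous_simpleTangent (s : SimpleFunc Ω ℝ) :
    Continuous fun μ : ProbRoot n Ω => (simpleTangent n μ.measure s : RootSpace n Ω) :=
  (continuous_simpleRoot s).sub
    ((continuous_meanAt continuous_id (continuous_simpleRoot s)).smul isometry_root.continuous)

theorem mem_closure_range_simpleTangent {μ : ProbabilityMeasure Ω} {x : RootSpace n Ω}
    (hx : x ∈ tangent n μ) :
    x ∈ closure (Set.range fun s => (simpleTangent n μ s : RootSpace n Ω)) := by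
  obtain ⟨φ, rfl⟩ := (mem_tangent_iff.mp hx).1
  have hcont : Continuous fun ψ => center n μ (dominated n (toFin μ) ψ) :=
    (center n μ).continuous.comp (isometry_dominated _).continuous
  have h : center n μ (dominated n (toFin μ) φ) ∈ _ :=
    image_closure_subset_closure_image hcont ⟨φ, denseRange_simpleLp (toFin μ) φ, rfl⟩
  rwa [center_eq_self hx, ← Set.range_comp] at h

theorem canonicalForm_simpleTangent (μ : ProbabilityMeasure Ω) (s : Fin n → SimpleFunc Ω ℝ) :
    canonicalForm n (fun i => (simpleTangent n μ (s i) : RootSpace n Ω)) =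
      (n : ℝ) ^ n * ∫ x, ∏ i, (s i x - ∫ y, s i y ∂(μ : Measure Ω)) ∂(μ : Measure Ω) := by
  simp only [coe_simpleTangent_eq_simpleRoot]
  refine (canonicalForm_dominated (toFin μ) _).trans ?_
  congr 1
  refine integral_congr_ae ?_
  filter_upwards [ae_all_iff.mpr fun i => coeFn_simpleLp (n := n) (toFin μ)
    (s i - SimpleFunc.const Ω (∫ x, s i x ∂(μ : Measure Ω)))] with x hx
  simp only [hx, SimpleFunc.coe_sub, Pi.sub_apply, SimpleFunc.const_apply]

end SimpleFunctions

section CongruentKernels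

variable {Ω : Type u} [MeasurableSpace Ω] {Ω' : Type v} [MeasurableSpace Ω'] {K : Kernel Ω Ω'}
  {κ : Ω' → Ω}

theorem map_comp_of_congruent (hκ : Measurable κ) (hK : ∀ ω, (K ω).map κ = Measure.dirac ω)
    (μ : Measure Ω) : (K ∘ₘ μ).map κ = μ := by
  have map_eq_id : K.map κ = Kernel.id := by
    ext1 ω
    rw [Kernel.map_apply _ hκ, hK, Kernel.id_apply]
  rw [Measure.map_comp _ _ hκ, map_eq_id, Measure.id_comp]

theorem comp_ae_eq_const_of_congruent (hκ : Measurable κ)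
    (hK : ∀ ω, (K ω).map κ = Measure.dirac ω) {φ : Ω → ℝ} (hφ : Measurable φ) (ω : Ω) :
    ∀ᵐ y ∂(K ω), φ (κ y) = φ ω := by
  have hm : MeasurableSet {x | φ x = φ ω} := hφ (measurableSet_singleton (φ ω))
  have h : ∀ᵐ x ∂(K ω).map κ, φ x = φ ω := by
    rw [hK, ae_dirac_iff hm]
  exact (ae_map_iff hκ.aemeasurable hm).mp h

variable [IsMarkovKernel K]

theorem kernelDensity_of_congruent (hκ : Measurable κ) (hK : ∀ ω, (K ω).map κ = Measure.dirac ω)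
    (μ : Measure Ω) [IsFiniteMeasure μ] {φ : Ω → ℝ} (hm : Measurable φ) (hφ : Integrable φ μ) :
    kernelDensity K μ φ =ᵐ[K ∘ₘ μ] φ ∘ κ := by
  have hi : Integrable (φ ∘ κ) (K ∘ₘ μ) := by
    rwa [← integrable_map_measure hm.aestronglyMeasurable hκ.aemeasurable,
      map_comp_of_congruent hκ hK]
  refine Integrable.ae_eq_of_forall_setIntegral_eq _ _ (integrable_kernelDensity K μ φ) hi
    fun A hA _ => ?_
  have fibre_integral : ∀ ω, ∫ y in A, (φ ∘ κ) y ∂K ω = φ ω * (K ω).real A := fun ω => by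
    calc ∫ y in A, (φ ∘ κ) y ∂K ω
        = ∫ _ in A, φ ω ∂K ω :=
          integral_congr_ae (ae_restrict_of_ae (comp_ae_eq_const_of_congruent hκ hK hm ω))
      _ = φ ω * (K ω).real A := by rw [setIntegral_const, smul_eq_mul, mul_comm]
  rw [Measure.comp_eq_comp_const_apply] at hi
  rw [setIntegral_kernelDensity K μ hm hφ hA, Measure.comp_eq_comp_const_apply,
    Kernel.setIntegral_comp hA hi.integrableOn, Kernel.const_apply]
  simp only [fibre_integral]

variable {n : ℕ} [NeZero n]

theorem coe_formalDeriv (K : Kernel Ω Ω') [IsMarkovKernel K] (μ : ProbabilityMeasure Ω)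
    (V : tangent n μ) {φ : Lp ℝ n (toFin μ).val} (hV : (V : RootSpace n Ω) = dominated n _ φ) :
    (formalDeriv n K μ V : RootSpace n Ω') = dominated n (toFin (push K μ)) (densityMap K μ φ) := by
  obtain ⟨W, rfl⟩ := (tangentEquiv n μ).surjective V
  obtain rfl : (W : Lp ℝ n (toFin μ).val) = φ := dominated_injective _ hV
  simp only [formalDeriv, LinearMap.comp_apply, LinearEquiv.coe_coe, LinearEquiv.symm_apply_apply]
  rfl

theorem densityMap_simpleLp_of_congruent (hκ : Measurable κ)
    (hK : ∀ ω, (K ω).map κ = Measure.dirac ω) (μ : ProbabilityMeasure Ω) (s : SimpleFunc Ω ℝ) :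
    densityMap K μ (simpleLp n _ s) = simpleLp n _ (s.comp κ hκ) := by
  have hcomp : simpleLp n (toFin μ) s ∘ κ =ᵐ[K ∘ₘ (μ : Measure Ω)] s ∘ κ := by
    refine ae_eq_comp hκ.aemeasurable ?_
    rw [map_comp_of_congruent hκ hK]
    exact coeFn_simpleLp (toFin μ) s
  apply Lp.ext
  calc densityMap K μ (simpleLp n _ s)
      =ᵐ[K ∘ₘ (μ : Measure Ω)] kernelDensity K μ (simpleLp n (toFin μ) s) :=
        MemLp.coeFn_toLp (memLp_kernelDensity_coe K μ _)
    _ =ᵐ[K ∘ₘ (μ : Measure Ω)] simpleLp n (toFin μ) s ∘ κ :=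
        kernelDensity_of_congruent hκ hK _ (Lp.stronglyMeasurable _).measurable (integrable_coe _)
    _ =ᵐ[K ∘ₘ (μ : Measure Ω)] s ∘ κ := hcomp
    _ =ᵐ[K ∘ₘ (μ : Measure Ω)] simpleLp n (toFin (push K μ)) (s.comp κ hκ) :=
        (coeFn_simpleLp (toFin (push K μ)) (s.comp κ hκ)).symm

theorem formalDeriv_simpleTangent (hκ : Measurable κ) (hK : ∀ ω, (K ω).map κ = Measure.dirac ω)
    (μ : ProbabilityMeasure Ω) (s : SimpleFunc Ω ℝ) :
    formalDeriv n K μ (simpleTangent n μ s) = simpleTangent n (push K μ) (s.comp κ hκ) := by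
  have integral_eq : ∫ y, s.comp κ hκ y ∂(push K μ : Measure Ω') = ∫ x, s x ∂(μ : Measure Ω) := by
    conv_rhs => rw [← map_comp_of_congruent hκ hK (μ : Measure Ω)]
    exact (integral_map hκ.aemeasurable s.aestronglyMeasurable).symm
  apply Subtype.ext
  rw [coe_formalDeriv K μ _ (coe_simpleTangent_eq_simpleRoot μ s), coe_simpleTangent_eq_simpleRoot,
    densityMap_simpleLp_of_congruent hκ hK, integral_eq]
  rfl

theorem form_push_simpleTangent {Ω Ω' : Type u} [MeasurableSpace Ω] [MeasurableSpace Ω']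
    {Θ : ∀ (Ω : Type u) [MeasurableSpace Ω], TensorField n Ω n} (hΘ : IsCongruentFamily Θ)
    {K : Kernel Ω Ω'} [IsMarkovKernel K] {κ : Ω' → Ω}
    (hκ : Measurable κ) (hK : ∀ ω, (K ω).map κ = Measure.dirac ω) (μ : ProbabilityMeasure Ω)
    (s : Fin n → SimpleFunc Ω ℝ) :
    (Θ Ω').form (push K μ) (fun i => simpleTangent n _ ((s i).comp κ hκ)) =
      (Θ Ω).form μ fun i => simpleTangent n μ (s i) := by
  rw [← hΘ Ω Ω' K ⟨κ, hκ, hK⟩ μ]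
  simp only [markovPullback, MultilinearMap.compLinearMap_apply, formalDeriv_simpleTangent hκ hK]

end CongruentKernels

section FiniteStatistics

variable {Ω : Type u} [MeasurableSpace Ω] {J : Type v} [Finite J] [MeasurableSpace J]
  [MeasurableSingletonClass J]

open scoped Classical in
/-- The conditional distributions of `μ` on the fibres of a surjective statistic with finitely many
values; on a null fibre some point mass is chosen. -/
def fibreKernel (μ : Measure Ω) {κ : Ω → J} (hs : Function.Surjective κ) : Kernel J Ω :=
  Kernel.ofFunOfCountable fun j =>
    if μ (κ ⁻¹' {j}) = 0 then Measure.dirac (Function.surjInv hs j) else μ[|κ ⁻¹' {j}]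

variable (μ : Measure Ω) {κ : Ω → J} (hs : Function.Surjective κ)

theorem fibreKernel_apply_of_null {j : J} (h : μ (κ ⁻¹' {j}) = 0) :
    fibreKernel μ hs j = Measure.dirac (Function.surjInv hs j) := if_pos h

theorem fibreKernel_apply {j : J} (h : μ (κ ⁻¹' {j}) ≠ 0) :
    fibreKernel μ hs j = μ[|κ ⁻¹' {j}] := if_neg h

variable [IsFiniteMeasure μ]

instance isMarkovKernel_fibreKernel : IsMarkovKernel (fibreKernel μ hs) := by
  refine ⟨fun j => ?_⟩
  by_cases h : μ (κ ⁻¹' {j}) = 0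
  · rw [fibreKernel_apply_of_null μ hs h]; infer_instance
  · rw [fibreKernel_apply μ hs h]; exact cond_isProbabilityMeasure h

theorem map_fibreKernel (hκ : Measurable κ) (j : J) :
    (fibreKernel μ hs j).map κ = Measure.dirac j := by
  by_cases h : μ (κ ⁻¹' {j}) = 0
  · rw [fibreKernel_apply_of_null μ hs h, Measure.map_dirac' hκ, Function.surjInv_eq hs]
  · rw [fibreKernel_apply μ hs h]
    have := cond_isProbabilityMeasure h
    have hae : κ =ᵐ[μ[|κ ⁻¹' {j}]] fun _ => j :=
      ae_cond_mem (hκ (measurableSet_singleton j))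
    rw [Measure.map_congr hae, Measure.map_const, measure_univ, one_smul]

theorem fibreKernel_comp_map (hκ : Measurable κ) : fibreKernel μ hs ∘ₘ μ.map κ = μ := by
  have := Fintype.ofFinite J
  ext A hA
  conv_rhs => rw [← sum_meas_smul_cond_fiber hκ μ]
  rw [Measure.bind_apply hA (Kernel.aemeasurable _), lintegral_fintype, Measure.finsetSum_apply]
  refine Finset.sum_congr rfl fun j _ => ?_
  rw [Measure.map_apply hκ (measurableSet_singleton j), Measure.smul_apply, smul_eq_mul, mul_comm]
  by_cases h : μ (κ ⁻¹' {j}) = 0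
  · rw [h, zero_mul, zero_mul]
  · rw [fibreKernel_apply μ hs h]

theorem form_comp_simpleTangent {J : Type u} [Finite J] [MeasurableSpace J]
    [MeasurableSingletonClass J] {n : ℕ} [NeZero n]
    {Θ : ∀ (Ω : Type u) [MeasurableSpace Ω], TensorField n Ω n} (hΘ : IsCongruentFamily Θ)
    (μ : ProbabilityMeasure Ω) {κ : Ω → J} (hκ : Measurable κ) (hs : Function.Surjective κ)
    (s : Fin n → SimpleFunc J ℝ) :
    (Θ Ω).form μ (fun i => simpleTangent n μ ((s i).comp κ hκ)) =
      (Θ J).form (μ.map hκ.aemeasurable) fun i => simpleTangent n _ (s i) := by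
  have h := form_push_simpleTangent hΘ hκ (map_fibreKernel (μ : Measure Ω) hs hκ)
    (μ.map hκ.aemeasurable) s
  have push_eq : push (fibreKernel (μ : Measure Ω) hs) (μ.map hκ.aemeasurable) = μ :=
    Subtype.ext (fibreKernel_comp_map (μ : Measure Ω) hs hκ)
  rwa [push_eq] at h

theorem canonicalForm_comp_simpleTangent {J : Type v} [MeasurableSpace J] {n : ℕ} [NeZero n]
    (μ : ProbabilityMeasure Ω) {κ : Ω → J} (hκ : Measurable κ) (s : Fin n → SimpleFunc J ℝ) :
    canonicalForm n (fun i => (simpleTangent n μ ((s i).comp κ hκ) : RootSpace n Ω)) =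
      canonicalForm n
        fun i => (simpleTangent n (μ.map hκ.aemeasurable) (s i) : RootSpace n J) := by
  have integral_eq : ∀ i, ∫ y, s i y ∂(μ.map hκ.aemeasurable : Measure J) =
      ∫ x, s i (κ x) ∂(μ : Measure Ω) := fun i =>
    integral_map hκ.aemeasurable (s i).aestronglyMeasurable
  rw [canonicalForm_simpleTangent, canonicalForm_simpleTangent]
  simp only [integral_eq]
  congr 1
  refine (integral_map (f := fun x => ∏ i, (s i x - ∫ y, s i (κ y) ∂(μ : Measure Ω)))
    hκ.aemeasurable ?_).symm
  exact (Finset.measurable_fun_prod _ fun i _ =>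
    (s i).measurable.sub_const _).aestronglyMeasurable

end FiniteStatistics

section Agreement

variable {n : ℕ} [NeZero n] {Ω : Type u} [MeasurableSpace Ω]

/-- The `n`-tensor `Ψ` is `c` times the canonical one on those tangent vectors at `μ` that are given
by simple functions. -/
def AgreesOnSimple (Ψ : TensorField n Ω n) (c : ℝ) (μ : ProbabilityMeasure Ω) : Prop :=
  ∀ s : Fin n → SimpleFunc Ω ℝ, (Ψ.form μ fun i => simpleTangent n μ (s i)) =
    c * canonicalForm n fun i => (simpleTangent n μ (s i) : RootSpace n Ω)

theorem AgreesOnSimple.map {Θ : ∀ (Ω : Type u) [MeasurableSpace Ω], TensorField n Ω n}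
    (hΘ : IsCongruentFamily Θ) {J : Type u} [Finite J] [MeasurableSpace J]
    [MeasurableSingletonClass J] {c : ℝ} {μ : ProbabilityMeasure Ω}
    (h : AgreesOnSimple (Θ Ω) c μ) {κ : Ω → J} (hκ : Measurable κ) (hs : Function.Surjective κ) :
    AgreesOnSimple (Θ J) c (μ.map hκ.aemeasurable) := fun s => by
  rw [← form_comp_simpleTangent hΘ μ hκ hs s, h, canonicalForm_comp_simpleTangent]

/-- The vector field `μ^{1/n} ↦ (s - E_μ(s)) μ^{1/n}` of a simple function `s`. -/
def simpleField (s : SimpleFunc Ω ℝ) : VectorField n Ω where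
  toFun μ := simpleTangent n μ.measure s
  continuous_toFun := continuous_simpleTangent s
  mem_tangent μ := (simpleTangent n μ.measure s).2

theorem isClosed_setOf_form_eq_mul_canonicalForm (Ψ : TensorField n Ω n) (c : ℝ)
    (X : Fin n → VectorField n Ω) :
    IsClosed {μ : ProbRoot n Ω |
      (Ψ.form μ.measure fun j => ⟨(X j).toFun μ, (X j).mem_tangent μ⟩) =
        c * canonicalForm n fun j => (X j).toFun μ} :=
  isClosed_eq (Ψ.continuous_form X) (continuous_const.mul
    (continuous_canonicalForm.comp (continuous_pi fun j => (X j).continuous_toFun)))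

end Agreement

section PermutationInvariance

theorem exists_perm_comp_eq {J : Type*} [Finite J] {ι : Type*} {x y : ι → J}
    (h : ∀ i j, x i = x j ↔ y i = y j) : ∃ σ : Equiv.Perm J, σ ∘ x = y := by
  have hy : ∀ i, y (Set.rangeSplitting x ⟨x i, i, rfl⟩) = y i := fun i =>
    (h _ _).mp (Set.apply_rangeSplitting x _)
  obtain ⟨σ, hσ⟩ := Equiv.Perm.exists_extending_pair (Subtype.val : Set.range x → J)
    (y ∘ Set.rangeSplitting x) Subtype.val_injective fun a b hab => by
      have := (h _ _).mpr hab
      rwa [Set.apply_rangeSplitting x a, Set.apply_rangeSplitting x b, Subtype.coe_inj] at this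
  exact ⟨σ, funext fun i => (hσ ⟨x i, i, rfl⟩).trans (hy i)⟩

theorem exists_eq_of_perm_invariant {J α ι : Type*} [Finite J] {T : (ι → J) → ℝ}
    (hT : ∀ (σ : Equiv.Perm J) x, T (σ ∘ x) = T x) (p : ι → α) :
    ∃ t, ∀ x, (∀ i j, x i = x j ↔ p i = p j) → T x = t := by
  by_cases h : ∃ x₀ : ι → J, ∀ i j, x₀ i = x₀ j ↔ p i = p j
  · obtain ⟨x₀, h₀⟩ := h
    refine ⟨T x₀, fun x hx => ?_⟩
    obtain ⟨σ, rfl⟩ := exists_perm_comp_eq fun i j => (h₀ i j).trans (hx i j).symm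
    exact hT σ x₀
  · exact ⟨0, fun x hx => (h ⟨x, hx⟩).elim⟩

theorem map_single_perm_comp {J : Type*} [DecidableEq J] {n : ℕ}
    {M : MultilinearMap ℝ (fun _ : Fin n => J → ℝ) ℝ}
    (hM : ∀ (σ : Equiv.Perm J) (f : Fin n → J → ℝ), M (fun i => f i ∘ σ) = M f)
    (σ : Equiv.Perm J) (x : Fin n → J) :
    (M fun i => Pi.single ((σ ∘ x) i) 1) = M fun i => Pi.single (x i) 1 := by
  rw [← hM σ]
  congr 1
  funext i j
  simp [Pi.single_apply, Function.comp_apply]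

variable {J : Type*} [Fintype J]

theorem sum_prod_mul_eq_zero {ι : Type*} [Fintype ι] [DecidableEq ι] {f : ι → J → ℝ} {l : ι}
    (hf : ∑ j, f l j = 0) {g : (ι → J) → ℝ} (hg : ∀ x j, g (Function.update x l j) = g x) :
    ∑ x, (∏ i, f i (x i)) * g x = 0 := by
  rw [← (Equiv.funSplitAt l J).symm.sum_comp, Fintype.sum_prod_type_right]
  refine Finset.sum_eq_zero fun y _ => ?_
  cases isEmpty_or_nonempty J
  · exact Fintype.sum_empty _
  obtain ⟨j₀⟩ := ‹Nonempty J›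
  have g_eq : ∀ j, g ((Equiv.funSplitAt l J).symm (j, y)) =
      g ((Equiv.funSplitAt l J).symm (j₀, y)) := fun j => by
    rw [← hg ((Equiv.funSplitAt l J).symm (j₀, y)) j]
    congr 1
    funext i
    by_cases h : i = l <;> simp [h, Equiv.funSplitAt, Equiv.piSplitAt, Function.update]
  have prod_eq : ∀ j, ∏ i, f i ((Equiv.funSplitAt l J).symm (j, y) i) =
      f l j * ∏ i : {i // i ≠ l}, f i (y i) := fun j => by
    rw [Fintype.prod_eq_mul_prod_subtype_ne _ l]
    congr 1
    · simp
    · exact Finset.prod_congr rfl fun i _ => by simp [i.2]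
  simp only [g_eq, prod_eq, mul_assoc, ← Finset.sum_mul, hf, zero_mul]

section DecidableEq

variable [DecidableEq J]

theorem multilinearMap_eq_sum {n : ℕ} (M : MultilinearMap ℝ (fun _ : Fin n => J → ℝ) ℝ)
    (f : Fin n → J → ℝ) :
    M f = ∑ x : Fin n → J, (∏ i, f i (x i)) * M fun i => Pi.single (x i) 1 := by
  have hf : f = fun i => ∑ j, f i j • (Pi.single j (1 : ℝ) : J → ℝ) :=
    funext fun i => pi_eq_sum_univ' (f i)
  conv_lhs => rw [hf]
  rw [MultilinearMap.map_sum]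
  exact Finset.sum_congr rfl fun x _ => by
    rw [MultilinearMap.map_smul_univ M (fun i => f i (x i)), smul_eq_mul]

theorem sum_prod_mul_ite_const {n : ℕ} [NeZero n] (f : Fin n → J → ℝ) (d : ℝ) :
    ∑ x : Fin n → J, (∏ i, f i (x i)) * (if ∀ i, x i = x 0 then d else 0) =
      d * ∑ j, ∏ i, f i j := by
  simp only [mul_ite, mul_zero]
  rw [← Finset.sum_filter, Finset.mul_sum]
  refine Finset.sum_nbij' (fun x => x 0) (fun j _ => j) (by simp) (by simp) ?_ (by simp) ?_
  · intro x hx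
    exact funext fun i => ((Finset.mem_filter.mp hx).2 i).symm
  · intro x hx
    simp only [(Finset.mem_filter.mp hx).2, mul_comm d]

theorem map_eq_mul_sum_prod {n : ℕ} [NeZero n]
    {M : MultilinearMap ℝ (fun _ : Fin n => J → ℝ) ℝ} {g : Fin n → (Fin n → J) → ℝ} {d : ℝ}
    (hg : ∀ l x j, g l (Function.update x l j) = g l x)
    (hM : ∀ x : Fin n → J, (M fun i => Pi.single (x i) 1) =
      ∑ l, g l x + if ∀ i, x i = x 0 then d else 0)
    {f : Fin n → J → ℝ} (hf : ∀ i, ∑ j, f i j = 0) : M f = d * ∑ j, ∏ i, f i j := by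
  simp only [multilinearMap_eq_sum M f, hM, mul_add, Finset.mul_sum, Finset.sum_add_distrib]
  rw [Finset.sum_comm, ← Finset.mul_sum, sum_prod_mul_ite_const, add_eq_right]
  exact Finset.sum_eq_zero fun l _ => sum_prod_mul_eq_zero (hf l) (hg l)

end DecidableEq

theorem bilinear_eq_of_perm_invariant {M : MultilinearMap ℝ (fun _ : Fin 2 => J → ℝ) ℝ}
    (hM : ∀ (σ : Equiv.Perm J) (f : Fin 2 → J → ℝ), M (fun i => f i ∘ σ) = M f) :
    ∃ d, ∀ f : Fin 2 → J → ℝ, (∀ i, ∑ j, f i j = 0) → M f = d * ∑ j, ∏ i, f i j := by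
  classical
  have hconst := fun p : Fin 2 → ℕ => exists_eq_of_perm_invariant
    (T := fun x => M fun i => Pi.single (x i) 1) (map_single_perm_comp hM) p
  obtain ⟨a, ha⟩ := hconst ![0, 0]
  obtain ⟨b, hb⟩ := hconst ![0, 1]
  let g : Fin 2 → (Fin 2 → J) → ℝ := ![fun _ => b, fun _ => 0]
  refine ⟨a - b, fun f => map_eq_mul_sum_prod (g := g) ?_ fun x => ?_⟩
  · simp [g]
  · by_cases h : x 1 = x 0
    · rw [ha x (by simp [Fin.forall_fin_two, h])]
      simp [g, Fin.forall_fin_two, h]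
    · rw [hb x (by simp [Fin.forall_fin_two, h, Ne.symm h])]
      simp [g, Fin.forall_fin_two, h]

theorem trilinear_eq_of_perm_invariant {M : MultilinearMap ℝ (fun _ : Fin 3 => J → ℝ) ℝ}
    (hM : ∀ (σ : Equiv.Perm J) (f : Fin 3 → J → ℝ), M (fun i => f i ∘ σ) = M f) :
    ∃ d, ∀ f : Fin 3 → J → ℝ, (∀ i, ∑ j, f i j = 0) → M f = d * ∑ j, ∏ i, f i j := by
  classical
  have hconst := fun p : Fin 3 → ℕ => exists_eq_of_perm_invariant
    (T := fun x => M fun i => Pi.single (x i) 1) (map_single_perm_comp hM) p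
  obtain ⟨a, ha⟩ := hconst ![0, 0, 0]
  obtain ⟨b₀, hb₀⟩ := hconst ![1, 0, 0]
  obtain ⟨b₁, hb₁⟩ := hconst ![0, 1, 0]
  obtain ⟨b₂, hb₂⟩ := hconst ![0, 0, 1]
  obtain ⟨c, hc⟩ := hconst ![0, 1, 2]
  let g : Fin 3 → (Fin 3 → J) → ℝ := ![
    fun x => if x 2 = x 1 then b₀ - c else 0,
    fun x => if x 2 = x 0 then b₁ - c else 0,
    fun x => c + if x 1 = x 0 then b₂ - c else 0]
  refine ⟨a - b₀ - b₁ - b₂ + 2 * c, fun f => map_eq_mul_sum_prod (g := g) ?_ fun x => ?_⟩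
  · simp [g, Fin.forall_fin_succ]
  · by_cases h₁ : x 1 = x 0 <;> by_cases h₂ : x 2 = x 0
    · rw [ha x (by simp [Fin.forall_fin_succ, h₁, h₂])]
      simp [g, Fin.sum_univ_three, Fin.forall_fin_succ, h₁, h₂]
      ring
    · rw [hb₂ x (by simp [Fin.forall_fin_succ, h₁, h₂, Ne.symm h₂])]
      simp [g, Fin.sum_univ_three, Fin.forall_fin_succ, h₁, h₂]
    · rw [hb₁ x (by simp [Fin.forall_fin_succ, h₁, h₂, Ne.symm h₁])]
      simp [g, Fin.sum_univ_three, Fin.forall_fin_succ, h₁, h₂, Ne.symm h₁]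
    · by_cases h₃ : x 2 = x 1
      · rw [hb₀ x (by simp [Fin.forall_fin_succ, h₁, h₃, Ne.symm h₁])]
        simp [g, Fin.sum_univ_three, Fin.forall_fin_succ, h₁, h₃]
      · rw [hc x (by
          simp [Fin.forall_fin_succ, h₁, h₂, h₃, Ne.symm h₁, Ne.symm h₂, Ne.symm h₃])]
        simp [g, Fin.sum_univ_three, Fin.forall_fin_succ, h₁, h₂, h₃]

theorem exists_eq_mul_sum_prod_of_perm_invariant {n : ℕ} (h2 : 2 ≤ n) (h3 : n ≤ 3)
    {M : MultilinearMap ℝ (fun _ : Fin n => J → ℝ) ℝ}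
    (hM : ∀ (σ : Equiv.Perm J) (f : Fin n → J → ℝ), M (fun i => f i ∘ σ) = M f) :
    ∃ d, ∀ f : Fin n → J → ℝ, (∀ i, ∑ j, f i j = 0) → M f = d * ∑ j, ∏ i, f i j := by
  interval_cases n
  · exact bilinear_eq_of_perm_invariant hM
  · exact trilinear_eq_of_perm_invariant hM

end PermutationInvariance

section UniformMeasures

/-- The uniform distribution on a finite set. -/
def uniformProb (J : Type u) [Finite J] [Nonempty J] [MeasurableSpace J]
    [MeasurableSingletonClass J] : ProbabilityMeasure J :=
  ⟨uniformOn Set.univ, isProbabilityMeasure_uniformOn Set.finite_univ Set.univ_nonempty⟩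

variable {J : Type u} [Finite J] [Nonempty J] [MeasurableSpace J] [MeasurableSingletonClass J]

theorem coe_uniformProb :
    (uniformProb J : Measure J) = (Nat.card J : ℝ≥0∞)⁻¹ • Measure.count := by
  change uniformOn Set.univ = _
  rw [uniformOn, ProbabilityTheory.cond, Measure.restrict_univ, Measure.count_univ,
    ENat.card_eq_coe_natCard, ENat.toENNReal_coe]

theorem integral_uniformProb [Fintype J] (f : J → ℝ) :
    ∫ x, f x ∂(uniformProb J : Measure J) = (Nat.card J : ℝ)⁻¹ * ∑ x, f x := by
  rw [coe_uniformProb, integral_smul_measure, integral_fintype Integrable.of_finite]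
  simp

theorem uniformProb_apply (A : Set J) :
    (uniformProb J : Measure J) A = (Nat.card J : ℝ≥0∞)⁻¹ * Nat.card A := by
  rw [coe_uniformProb, Measure.smul_apply, smul_eq_mul,
    Measure.count_apply A.toFinite.measurableSet, Nat.card_coe_set_eq,
    ← A.toFinite.cast_ncard_eq, ENat.toENNReal_coe]

theorem map_uniformProb {A : Type u} [Finite A] [Nonempty A] [MeasurableSpace A]
    [MeasurableSingletonClass A] {κ : A → J} (hκ : Measurable κ) {m : ℕ}
    (h : ∀ j, Nat.card (κ ⁻¹' {j}) = m) :
    (uniformProb A).map hκ.aemeasurable = uniformProb J := by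
  have card_eq : Nat.card A = Nat.card J * m := by
    have := Fintype.ofFinite J
    have h' : ∀ j, Nat.card {a // κ a = j} = m := h
    rw [Nat.card_congr (Equiv.sigmaFiberEquiv κ).symm, Nat.card_sigma]
    simp [h']
  have hm : (m : ℝ≥0∞) ≠ 0 :=
    Nat.cast_ne_zero.mpr (right_ne_zero_of_mul (card_eq ▸ Nat.card_pos.ne'))
  refine Subtype.ext (Measure.ext_of_singleton fun j => ?_)
  change (uniformProb A : Measure A).map κ {j} = (uniformProb J : Measure J) {j}
  rw [Measure.map_apply hκ (measurableSet_singleton j),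
    uniformProb_apply, uniformProb_apply, h, card_eq, Nat.cast_mul,
    ENNReal.mul_inv (Or.inr (ENNReal.natCast_ne_top m)) (Or.inr hm), mul_assoc,
    ENNReal.inv_mul_cancel hm (ENNReal.natCast_ne_top m), Nat.card_coe_set_eq, Set.ncard_singleton,
    Nat.cast_one]

/-- Functions on a finite set, as simple functions. -/
def ofFiniteLinear (J : Type u) [Finite J] [MeasurableSpace J] [MeasurableSingletonClass J] :
    (J → ℝ) →ₗ[ℝ] SimpleFunc J ℝ where
  toFun := SimpleFunc.ofFinite
  map_add' _ _ := rfl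
  map_smul' _ _ := rfl

theorem one_pow_add_one_pow_add_neg_two_pow_ne_zero {n : ℕ} (h2 : 2 ≤ n) :
    (1 : ℝ) ^ n + 1 ^ n + (-2) ^ n ≠ 0 := fun h => by
  have abs_eq : (2 : ℝ) ^ n = 2 := by
    calc (2 : ℝ) ^ n = |(-2) ^ n| := by rw [abs_pow, abs_neg, abs_two]
      _ = |-2| := by rw [one_pow] at h; congr 1; linarith
      _ = 2 := by rw [abs_neg, abs_two]
  have := pow_le_pow_right₀ (one_le_two (α := ℝ)) h2
  linarith

variable {n : ℕ} [NeZero n] {Θ : ∀ (Ω : Type u) [MeasurableSpace Ω], TensorField n Ω n}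

theorem form_uniformProb_perm (hΘ : IsCongruentFamily Θ) (σ : Equiv.Perm J)
    (f : Fin n → J → ℝ) :
    (Θ J).form (uniformProb J) (fun i => simpleTangent n _ (ofFiniteLinear J (f i ∘ σ))) =
      (Θ J).form (uniformProb J) fun i => simpleTangent n _ (ofFiniteLinear J (f i)) := by
  have hσ : Measurable σ := measurable_of_finite σ
  have h := form_comp_simpleTangent hΘ (uniformProb J) hσ σ.surjective
    fun i => ofFiniteLinear J (f i)
  have map_eq : (uniformProb J).map hσ.aemeasurable = uniformProb J :=
    map_uniformProb hσ (m := 1) fun j => by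
      rw [Nat.card_preimage_of_injective σ.injective (by simp), Nat.card_unique]
  rwa [map_eq] at h

theorem exists_agreesOnSimple_uniformProb (h2 : 2 ≤ n) (h3 : n ≤ 3) (hΘ : IsCongruentFamily Θ) :
    ∃ c, AgreesOnSimple (Θ J) c (uniformProb J) := by
  have := Fintype.ofFinite J
  let M : MultilinearMap ℝ (fun _ : Fin n => J → ℝ) ℝ :=
    ((Θ J).form (uniformProb J)).compLinearMap fun _ => simpleTangent n _ ∘ₗ ofFiniteLinear J
  obtain ⟨d, hd⟩ := exists_eq_mul_sum_prod_of_perm_invariant (M := M) h2 h3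
    (form_uniformProb_perm hΘ)
  have hn : ((n : ℝ) ^ n) ≠ 0 := pow_ne_zero _ (Nat.cast_ne_zero.mpr (NeZero.ne n))
  have hJ : (Nat.card J : ℝ) ≠ 0 := Nat.cast_ne_zero.mpr Nat.card_pos.ne'
  refine ⟨d * Nat.card J / (n : ℝ) ^ n, fun s => ?_⟩
  let f : Fin n → J → ℝ := fun i x => s i x - ∫ y, s i y ∂(uniformProb J : Measure J)
  have sum_f : ∀ i, ∑ j, f i j = 0 := fun i => by
    simp only [f, integral_uniformProb]
    rw [Finset.sum_sub_distrib, Finset.sum_const, Finset.card_univ, ← Nat.card_eq_fintype_card,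
      nsmul_eq_mul, mul_inv_cancel_left₀ hJ, sub_self]
  have simpleTangent_f : ∀ i, simpleTangent n (uniformProb J) (ofFiniteLinear J (f i)) =
      simpleTangent n (uniformProb J) (s i) := fun i => by
    have : ofFiniteLinear J (f i) =
        s i - SimpleFunc.const J (∫ y, s i y ∂(uniformProb J : Measure J)) := rfl
    rw [this, map_sub, simpleTangent_const, sub_zero]
  calc (Θ J).form (uniformProb J) (fun i => simpleTangent n _ (s i))
      = M f := by simp [M, simpleTangent_f]
    _ = d * ∑ j, ∏ i, f i j := hd f sum_f
    _ = _ := by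
      rw [canonicalForm_simpleTangent, integral_uniformProb]
      field_simp
      rfl

theorem exists_canonicalForm_simpleTangent_uniformProb_ne_zero (h2 : 2 ≤ n) :
    ∃ s : Fin n → SimpleFunc (ULift.{u} (Fin 3)) ℝ, canonicalForm n
      (fun i => (simpleTangent n (uniformProb (ULift.{u} (Fin 3))) (s i) :
        RootSpace n (ULift.{u} (Fin 3)))) ≠ 0 := by
  let f : ULift.{u} (Fin 3) → ℝ := fun b => ![1, 1, -2] b.down
  have sum_eq : ∀ g : ULift.{u} (Fin 3) → ℝ, ∑ b, g b = g ⟨0⟩ + g ⟨1⟩ + g ⟨2⟩ := fun g => by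
    rw [← Equiv.ulift.symm.sum_comp, Fin.sum_univ_three]; rfl
  have integral_f : ∫ y, ofFiniteLinear _ f y ∂(uniformProb (ULift.{u} (Fin 3)) : Measure _) =
      0 := by
    rw [integral_uniformProb, sum_eq]
    change _ * ((1 : ℝ) + 1 + -2) = 0
    norm_num
  refine ⟨fun _ => ofFiniteLinear _ f, ?_⟩
  simp only [canonicalForm_simpleTangent, integral_f, sub_zero, integral_uniformProb,
    Finset.prod_const, Finset.card_univ, Fintype.card_fin, sum_eq]
  exact mul_ne_zero (pow_ne_zero _ (Nat.cast_ne_zero.mpr (NeZero.ne n)))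
    (mul_ne_zero (inv_ne_zero (Nat.cast_ne_zero.mpr Nat.card_pos.ne'))
      (one_pow_add_one_pow_add_neg_two_pow_ne_zero h2))

theorem exists_agreesOnSimple_uniformProb_forall (h2 : 2 ≤ n) (h3 : n ≤ 3)
    (hΘ : IsCongruentFamily Θ) :
    ∃ c, ∀ (J : Type u) [Finite J] [Nonempty J] [MeasurableSpace J] [MeasurableSingletonClass J],
      AgreesOnSimple (Θ J) c (uniformProb J) := by
  let B := ULift.{u} (Fin 3)
  obtain ⟨c, hc⟩ := exists_agreesOnSimple_uniformProb (J := B) h2 h3 hΘ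
  obtain ⟨s, hs⟩ := exists_canonicalForm_simpleTangent_uniformProb_ne_zero h2
  refine ⟨c, fun J _ _ _ _ => ?_⟩
  obtain ⟨c', hc'⟩ := exists_agreesOnSimple_uniformProb (J := J × B) h2 h3 hΘ
  have agrees_J : AgreesOnSimple (Θ J) c' (uniformProb J) := by
    have h := hc'.map hΘ measurable_fst Prod.fst_surjective
    rwa [map_uniformProb measurable_fst (m := Nat.card B) fun j => by
      rw [← Set.prod_univ, Nat.card_coe_set_eq, Set.ncard_prod,
        Set.ncard_singleton, Set.ncard_univ, one_mul]] at h
  have agrees_B : AgreesOnSimple (Θ B) c' (uniformProb B) := by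
    have h := hc'.map hΘ measurable_snd Prod.snd_surjective
    rwa [map_uniformProb measurable_snd (m := Nat.card J) fun j => by
      rw [← Set.univ_prod, Nat.card_coe_set_eq, Set.ncard_prod,
        Set.ncard_singleton, Set.ncard_univ, mul_one]] at h
  obtain rfl : c = c' := mul_right_cancel₀ hs ((hc s).symm.trans (agrees_B s))
  exact agrees_J

end UniformMeasures

section FiniteSets

variable {J : Type u} [Finite J] [MeasurableSpace J] [MeasurableSingletonClass J]
  {n : ℕ} [NeZero n]

variable (J n) in
/-- The map `f ↦ f m^{1/n}`, where `m` is the counting measure of a finite set. -/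
def countMap : (J → ℝ) →ₗ[ℝ] RootSpace n J :=
  dominated n ⟨Measure.count, inferInstance⟩ ∘ₗ simpleLp n _ ∘ₗ ofFiniteLinear J

theorem root_eq_countMap (ν : ProbabilityMeasure J) :
    root n ν = countMap J n fun j => ((ν : Measure J).real {j}) ^ ((n : ℝ)⁻¹) := by
  have hn : (n : ℝ) ≠ 0 := Nat.cast_ne_zero.mpr (NeZero.ne n)
  refine root_eq_dominated_of_withDensity ν ⟨Measure.count, inferInstance⟩ (measurable_of_finite _)
    (fun j => Real.rpow_nonneg measureReal_nonneg _) ?_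
    ((SimpleFunc.ofFinite _).memLp_of_isFiniteMeasure n _)
  refine Measure.ext_of_singleton fun j => ?_
  rw [withDensity_apply _ (measurableSet_singleton j), lintegral_singleton,
    Measure.count_singleton, mul_one, ← Real.rpow_natCast, ← Real.rpow_mul
    measureReal_nonneg, inv_mul_cancel₀ hn, Real.rpow_one, ofReal_measureReal]

variable (n) in
/-- The root `μ^{1/n}` of a probability measure as a point of `P^{1/n}(Ω)`. -/
def toProbRoot {Ω : Type u} [MeasurableSpace Ω] (μ : ProbabilityMeasure Ω) : ProbRoot n Ω := μ

theorem tendsto_toProbRoot {ι : Type*} {l : Filter ι} {ν : ι → ProbabilityMeasure J}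
    {μ : ProbabilityMeasure J}
    (h : ∀ j, Filter.Tendsto (fun t => (ν t : Measure J).real {j}) l
      (nhds ((μ : Measure J).real {j}))) :
    Filter.Tendsto (fun t => toProbRoot n (ν t)) l (nhds (toProbRoot n μ)) := by
  refine isometry_root.isEmbedding.tendsto_nhds_iff.mpr ?_
  change Filter.Tendsto (fun t => root n (ν t)) l (nhds (root n μ))
  simp only [root_eq_countMap]
  refine ((countMap J n).continuous_of_finiteDimensional.tendsto _).comp
    (tendsto_pi_nhds.mpr fun j => ?_)
  exact (h j).rpow_const (Or.inr (by positivity))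

theorem exists_weights_tendsto {J : Type*} [Fintype J] (p : J → ℝ) (h0 : ∀ j, 0 ≤ p j)
    (h1 : ∑ j, p j = 1) :
    ∃ w : ℕ → J → ℕ, (∀ N j, 0 < w N j) ∧
      ∀ j, Filter.Tendsto (fun N => (w N j : ℝ) / ∑ i, (w N i : ℝ)) Filter.atTop
        (nhds (p j)) := by
  refine ⟨fun N j => ⌊p j * N⌋₊ + 1, fun _ _ => Nat.succ_pos _, fun j => ?_⟩
  have tendsto_div : ∀ j, Filter.Tendsto (fun N : ℕ => ((⌊p j * N⌋₊ + 1 : ℕ) : ℝ) / N)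
      Filter.atTop (nhds (p j)) := fun j => by
    have h := ((tendsto_nat_floor_mul_div_atTop (h0 j)).comp tendsto_natCast_atTop_atTop).add
      (tendsto_one_div_atTop_nhds_zero_nat (𝕜 := ℝ))
    rw [add_zero] at h
    exact h.congr fun N => by simp [add_div]
  have tendsto_sum_div : Filter.Tendsto (fun N : ℕ => ∑ j, ((⌊p j * N⌋₊ + 1 : ℕ) : ℝ) / N)
      Filter.atTop (nhds 1) := by
    rw [← h1]
    exact tendsto_finsetSum _ fun j _ => tendsto_div j
  have h := (tendsto_div j).div tendsto_sum_div one_ne_zero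
  rw [div_one] at h
  refine h.congr' ?_
  filter_upwards [Filter.eventually_ne_atTop 0] with N hN
  simp only [Pi.div_apply]
  rw [← Finset.sum_div, div_div_div_cancel_right₀ (Nat.cast_ne_zero.mpr hN)]

end FiniteSets

section UniformToAll

theorem exists_finite_factor {n : ℕ} {Ω : Type u} [MeasurableSpace Ω]
    (s : Fin n → SimpleFunc Ω ℝ) :
    ∃ (J : Type u) (_ : Finite J) (_ : MeasurableSpace J) (_ : MeasurableSingletonClass J)
      (κ : Ω → J) (hκ : Measurable κ) (t : Fin n → SimpleFunc J ℝ),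
      Function.Surjective κ ∧ ∀ i, s i = (t i).comp κ hκ := by
  let F : Ω → Fin n → ℝ := fun x i => s i x
  let J := Quotient (Setoid.ker F)
  let _ : MeasurableSpace J := ⊤
  have finite_range : (Set.range F).Finite :=
    (Set.Finite.pi' fun i => (s i).finite_range).subset (by
      rintro _ ⟨x, rfl⟩ i
      exact ⟨x, rfl⟩)
  have := finite_range.to_subtype
  have : Finite J := Finite.of_equiv _ (Setoid.quotientKerEquivRange F).symm
  have : MeasurableSingletonClass J := ⟨fun _ => trivial⟩
  have hκ : Measurable (Quotient.mk (Setoid.ker F)) := by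
    refine measurable_to_countable fun x => ?_
    have fibre_eq : Quotient.mk (Setoid.ker F) ⁻¹' {Quotient.mk (Setoid.ker F) x} =
        ⋂ i, s i ⁻¹' {s i x} := by
      ext y
      simp only [Set.mem_preimage, Set.mem_singleton_iff, Set.mem_iInter, Quotient.eq]
      exact funext_iff
    rw [fibre_eq]
    exact MeasurableSet.iInter fun i => (s i).measurableSet_fiber _
  exact ⟨J, inferInstance, inferInstance, inferInstance, Quotient.mk _, hκ,
    fun i => SimpleFunc.ofFinite (Quotient.lift (s i) fun a b h => congrFun h i),
    Quotient.mk_surjective, fun i => SimpleFunc.ext fun x => rfl⟩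

variable {n : ℕ} [NeZero n] {Θ : ∀ (Ω : Type u) [MeasurableSpace Ω], TensorField n Ω n} {c : ℝ}
  (hΘ : IsCongruentFamily Θ)
  (hu : ∀ (J : Type u) [Finite J] [Nonempty J] [MeasurableSpace J] [MeasurableSingletonClass J],
    AgreesOnSimple (Θ J) c (uniformProb J))
include hΘ hu

theorem exists_agreesOnSimple_of_weights {J : Type u} [Fintype J] [Nonempty J] [MeasurableSpace J]
    [MeasurableSingletonClass J] (w : J → ℕ) (hw : ∀ j, 0 < w j) :
    ∃ ν : ProbabilityMeasure J, (∀ j, (ν : Measure J).real {j} = w j / ∑ i, (w i : ℝ)) ∧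
      AgreesOnSimple (Θ J) c ν := by
  let A := Σ j, Fin (w j)
  let _ : MeasurableSpace A := ⊤
  have : MeasurableSingletonClass A := ⟨fun _ => trivial⟩
  have : Nonempty A := ⟨⟨Classical.arbitrary J, ⟨0, hw _⟩⟩⟩
  have hκ : Measurable (Sigma.fst : A → J) := measurable_from_top
  refine ⟨(uniformProb A).map hκ.aemeasurable, fun j => ?_,
    (hu A).map hΘ hκ fun j => ⟨⟨j, ⟨0, hw j⟩⟩, rfl⟩⟩
  have card_fibre : Nat.card ((Sigma.fst : A → J) ⁻¹' {j}) = w j := by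
    rw [← Set.range_sigmaMk, Nat.card_range_of_injective sigma_mk_injective, Nat.card_fin]
  have card_eq : Nat.card A = ∑ i, w i := by simp [A]
  rw [measureReal_def, ProbabilityMeasure.toMeasure_map,
    Measure.map_apply hκ (measurableSet_singleton j), uniformProb_apply, card_fibre, card_eq,
    ENNReal.toReal_mul, ENNReal.toReal_inv, ENNReal.toReal_natCast, ENNReal.toReal_natCast,
    Nat.cast_sum, div_eq_inv_mul]

theorem agreesOnSimple_of_finite {J : Type u} [Finite J] [MeasurableSpace J]
    [MeasurableSingletonClass J] (μ : ProbabilityMeasure J) : AgreesOnSimple (Θ J) c μ :=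
  fun s => by
  have := Fintype.ofFinite J
  have : Nonempty J := nonempty_of_isProbabilityMeasure (μ : Measure J)
  obtain ⟨w, hw, hlim⟩ := exists_weights_tendsto (fun j => (μ : Measure J).real {j})
    (fun j => measureReal_nonneg) (by rw [sum_measureReal_singleton]; simp)
  choose ν hν hν' using fun N => exists_agreesOnSimple_of_weights hΘ hu (w N) (hw N)
  have ht : Filter.Tendsto (fun N => toProbRoot n (ν N)) Filter.atTop (nhds (toProbRoot n μ)) :=
    tendsto_toProbRoot fun j => by simpa only [hν] using hlim j
  exact (isClosed_setOf_form_eq_mul_canonicalForm (Θ J) c fun i => simpleField (s i)).mem_of_tendsto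
    ht (Filter.Eventually.of_forall fun N => hν' N s)

theorem agreesOnSimple_of_uniformProb {Ω : Type u} [MeasurableSpace Ω]
    (μ : ProbabilityMeasure Ω) : AgreesOnSimple (Θ Ω) c μ := fun s => by
  obtain ⟨J, _, _, _, κ, hκ, t, hs, hst⟩ := exists_finite_factor s
  simp only [hst]
  rw [form_comp_simpleTangent hΘ μ hκ hs t, canonicalForm_comp_simpleTangent,
    agreesOnSimple_of_finite hΘ hu]

end UniformToAll

section VectorFieldThroughTangentVector

theorem continuous_of_tendsto_sum {X E : Type*} [TopologicalSpace X] [SeminormedAddCommGroup E]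
    {f : ℕ → X → E} {F : X → E} {b : ℕ → ℝ} (hf : ∀ i, Continuous (f i)) (hb : Summable b)
    (hfb : ∀ i x, ‖f i x‖ ≤ b i)
    (hF : ∀ x, Filter.Tendsto (fun N => ∑ i ∈ Finset.range N, f i x) Filter.atTop (nhds (F x))) :
    Continuous F := by
  have hu : TendstoUniformly (fun N x => ∑ i ∈ Finset.range N, f i x) F Filter.atTop := by
    rw [Metric.tendstoUniformly_iff]
    intro ε hε
    filter_upwards [(tendsto_sum_nat_add b).eventually_lt_const hε] with N hN x
    rw [dist_comm]
    refine lt_of_le_of_lt (dist_le_tsum_of_dist_le_of_tendsto b (fun i => ?_) hb (hF x) N) ?_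
    · rw [Finset.sum_range_succ, dist_self_add_right]
      exact hfb i x
    · simpa only [add_comm N] using hN
  exact hu.continuous (Filter.Frequently.of_forall fun N =>
    continuous_finsetSum _ fun i _ => hf i)

theorem exists_summable_norm_tendsto_of_mem_closure_range {S E : Type*} [AddCommGroup S]
    [SeminormedAddCommGroup E] (f : S →+ E) {v : E} (hv : v ∈ closure (Set.range f)) :
    ∃ s : ℕ → S, (Summable fun i => ‖f (s i)‖) ∧
      Filter.Tendsto (fun N => ∑ i ∈ Finset.range N, f (s i)) Filter.atTop (nhds v) := by
  obtain ⟨u, hu, hmem, -, hbound⟩ := controlled_sum_of_mem_closure (s := f.range) (a := v)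
    (b := fun i => (1 / 2 : ℝ) ^ i) (by rwa [AddMonoidHom.coe_range]) fun i => by positivity
  choose s hs using hmem
  refine ⟨s, ?_, ?_⟩
  · simp only [hs]
    refine (summable_nat_add_iff 1).mp (Summable.of_nonneg_of_le (fun i => norm_nonneg _)
      (fun i => (hbound (i + 1) (Nat.succ_pos i)).le) ?_)
    exact (summable_nat_add_iff 1).mpr summable_geometric_two
  · rw [← Filter.tendsto_add_atTop_iff_nat 1]
    simpa only [hs] using hu

theorem exists_cutoff {X E : Type*} [PseudoMetricSpace X] [SeminormedAddCommGroup E]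
    [NormedSpace ℝ E] {f : X → E} (x₀ : X) (hf : ContinuousAt f x₀) {ε δ : ℝ} (hε : 0 < ε)
    (hδ : 0 < δ) :
    ∃ h : X → ℝ, Continuous h ∧ h x₀ = 1 ∧ (∀ x, δ ≤ dist x x₀ → h x = 0) ∧
      ∀ x, ‖h x • f x‖ ≤ ‖f x₀‖ + ε := by
  obtain ⟨r, hr, hfr⟩ := Metric.continuousAt_iff.mp hf ε hε
  have hpos : 0 < min r δ := lt_min hr hδ
  let h : X → ℝ := fun x => thickenedIndicator hpos {x₀} x
  have h_eq_zero : ∀ x, min r δ ≤ dist x x₀ → h x = 0 := fun x hx =>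
    NNReal.coe_eq_zero.mpr (thickenedIndicator_zero hpos {x₀} (by
      rwa [Metric.thickening_singleton, Metric.mem_ball, not_lt]))
  refine ⟨h, ?_, ?_, fun x hx => h_eq_zero x ((min_le_right r δ).trans hx), fun x => ?_⟩
  · exact NNReal.continuous_coe.comp (thickenedIndicator hpos {x₀}).continuous
  · exact NNReal.coe_eq_one.mpr (thickenedIndicator_one hpos {x₀} rfl)
  rcases le_or_gt (min r δ) (dist x x₀) with hx | hx
  · rw [h_eq_zero x hx, zero_smul, norm_zero]
    positivity
  · calc ‖h x • f x‖ = h x * ‖f x‖ := norm_smul_of_nonneg (NNReal.coe_nonneg _) _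
      _ ≤ ‖f x‖ := mul_le_of_le_one_left (norm_nonneg _)
        (NNReal.coe_le_one.mpr (thickenedIndicator_le_one hpos {x₀} x))
      _ ≤ ‖f x₀‖ + ‖f x - f x₀‖ := norm_le_norm_add_norm_sub' _ _
      _ ≤ ‖f x₀‖ + ε := by
        have := hfr (hx.trans_le (min_le_left r δ))
        rw [dist_eq_norm] at this
        gcongr

-- Cut off the `i`-th term of a series for `v` outside of the ball of radius `1 / (i + 1)`: at every
-- point other than `x₀` only finitely many terms survive.
theorem exists_continuous_mem_range_of_mem_closure {X S E : Type*} [MetricSpace X]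
    [AddCommGroup S] [Module ℝ S] [SeminormedAddCommGroup E] [NormedSpace ℝ E]
    {σ : X → S →ₗ[ℝ] E} (hσ : ∀ s, Continuous fun x => σ x s) (x₀ : X) {v : E}
    (hv : v ∈ closure (Set.range (σ x₀))) :
    ∃ F : X → E, Continuous F ∧ F x₀ = v ∧ ∀ x ≠ x₀, F x ∈ LinearMap.range (σ x) := by
  obtain ⟨s, hsum, hlim⟩ :=
    exists_summable_norm_tendsto_of_mem_closure_range (σ x₀).toAddMonoidHom hv
  choose h h_cont h_one h_zero h_bound using fun i : ℕ =>
    exists_cutoff x₀ (hσ (s i)).continuousAt (ε := (1 / 2) ^ i) (by positivity)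
      (Nat.one_div_pos_of_nat (α := ℝ) (n := i))
  have limit : ∀ x, ∃ y, Filter.Tendsto (fun N => ∑ i ∈ Finset.range N, h i x • σ x (s i))
      Filter.atTop (nhds y) ∧ (x = x₀ → y = v) ∧ (x ≠ x₀ → y ∈ LinearMap.range (σ x)) := fun x => by
    by_cases hx : x = x₀
    · subst hx
      refine ⟨v, ?_, fun _ => rfl, fun hne => (hne rfl).elim⟩
      simp only [h_one, one_smul]
      exact hlim
    · obtain ⟨N₀, hN₀⟩ := exists_nat_one_div_lt (dist_pos.mpr hx)
      refine ⟨_, tendsto_atTop_of_eventually_const (i₀ := N₀)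
        (x := ∑ i ∈ Finset.range N₀, h i x • σ x (s i)) fun N hN => ?_, fun heq => (hx heq).elim,
        fun _ => ⟨∑ i ∈ Finset.range N₀, h i x • s i, by simp only [map_sum, map_smul]⟩⟩
      refine (Finset.sum_subset (Finset.range_mono hN) fun i _ hi => ?_).symm
      have hi' : N₀ ≤ i := by simpa using hi
      rw [h_zero i x ((Nat.one_div_le_one_div hi').trans hN₀.le), zero_smul]
  choose F hF hFx₀ hFx using limit
  exact ⟨F, continuous_of_tendsto_sum (fun i => (h_cont i).smul (hσ (s i)))
    (hsum.add summable_geometric_two) h_bound hF, hFx₀ x₀ rfl, hFx⟩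

theorem exists_vectorField_eq_simpleTangent {Ω : Type u} [MeasurableSpace Ω] {n : ℕ} [NeZero n]
    (μ : ProbRoot n Ω) (V : tangent n μ.measure) :
    ∃ X : VectorField n Ω, X.toFun μ = V ∧
      ∀ ν ≠ μ, ∃ s, X.toFun ν = simpleTangent n ν.measure s := by
  obtain ⟨F, hF, hFμ, hFν⟩ := exists_continuous_mem_range_of_mem_closure
    (σ := fun ν : ProbRoot n Ω => (tangent n ν.measure).subtype ∘ₗ simpleTangent n ν.measure)
    continuous_simpleTangent μ (mem_closure_range_simpleTangent V.2)
  have mem_tangent : ∀ ν, F ν ∈ tangent n ν.measure := fun ν => by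
    by_cases hν : ν = μ
    · subst hν
      exact hFμ ▸ V.2
    · obtain ⟨s, hs⟩ := hFν ν hν
      exact hs ▸ Subtype.prop _
  refine ⟨⟨F, hF, mem_tangent⟩, hFμ, fun ν hν => ?_⟩
  obtain ⟨s, hs⟩ := hFν ν hν
  exact ⟨s, hs.symm⟩

end VectorFieldThroughTangentVector

section NotIsolated

variable {Ω : Type u} [MeasurableSpace Ω] {n : ℕ} [NeZero n]

theorem abs_sub_one_le_abs_pow_sub_one {x : ℝ} (hx : 0 ≤ x) {k : ℕ} (hk : k ≠ 0) :
    |x - 1| ≤ |x ^ k - 1| := by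
  rcases le_total 1 x with h | h
  · rw [abs_of_nonneg (sub_nonneg.mpr h), abs_of_nonneg (sub_nonneg.mpr (one_le_pow₀ h))]
    exact sub_le_sub_right (le_self_pow₀ h hk) 1
  · rw [abs_of_nonpos (sub_nonpos.mpr h), abs_of_nonpos (sub_nonpos.mpr (pow_le_one₀ hx h))]
    exact neg_le_neg (sub_le_sub_right (pow_le_of_le_one hx h hk) 1)

theorem norm_root_sub_root_le_of_withDensity {μ ν : ProbabilityMeasure Ω} {y : Ω → ℝ}
    (hy : Measurable y) {ε : ℝ} (hyε : ∀ x, |y x| ≤ ε) (hε : ε ≤ 1)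
    (hν : (ν : Measure Ω) = (μ : Measure Ω).withDensity fun x => ENNReal.ofReal (1 + y x)) :
    ‖root n ν - root n μ‖ ≤ ε := by
  obtain ⟨x₀⟩ := nonempty_of_isProbabilityMeasure (μ : Measure Ω)
  have hε0 : 0 ≤ ε := (abs_nonneg _).trans (hyε x₀)
  have h_nonneg : ∀ x, 0 ≤ 1 + y x := fun x => by linarith [(abs_le.mp (hyε x)).1]
  let g : Ω → ℝ := fun x => (1 + y x) ^ ((n : ℝ)⁻¹)
  have g_nonneg : ∀ x, 0 ≤ g x := fun x => Real.rpow_nonneg (h_nonneg x) _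
  have g_pow : ∀ x, g x ^ n = 1 + y x := fun x =>
    Real.rpow_inv_natCast_pow (h_nonneg x) (NeZero.ne n)
  have g_meas : Measurable g := (hy.const_add 1).pow_const _
  have g_near : ∀ x, ‖g x - 1‖ ≤ ε := fun x =>
    calc |g x - 1| ≤ |g x ^ n - 1| := abs_sub_one_le_abs_pow_sub_one (g_nonneg x) (NeZero.ne n)
      _ = |y x| := by rw [g_pow, add_sub_cancel_left]
      _ ≤ ε := hyε x
  have g_one_memLp : MemLp (fun x => g x - 1) n (toFin μ).val :=
    MemLp.of_bound (g_meas.sub_const 1).aestronglyMeasurable ε (Filter.Eventually.of_forall g_near)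
  have g_memLp : MemLp g n (toFin μ).val :=
    (g_one_memLp.add (memLp_const 1)).ae_eq (by simp [Pi.add_def])
  rw [root_eq_dominated_of_withDensity ν (toFin μ) g_meas g_nonneg (by simp only [g_pow]; exact hν)
    g_memLp, root, ← map_sub, norm_dominated, ← MemLp.toLp_sub]
  refine (Lp.norm_le_of_ae_bound hε0 ?_).trans (by simp [measureUnivNNReal])
  filter_upwards [MemLp.coeFn_toLp (g_memLp.sub (memLp_const (1 : ℝ)))] with x hx
  rw [hx]
  exact g_near x

theorem exists_ne_norm_root_sub_root_le {μ : ProbabilityMeasure Ω} {y : Ω → ℝ}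
    (hy : Measurable y) {ε : ℝ} (hyε : ∀ x, |y x| ≤ ε) (hε : ε ≤ 1)
    (hy_int : ∫ x, y x ∂(μ : Measure Ω) = 0) (hy_ne : ¬ y =ᵐ[(μ : Measure Ω)] 0) :
    ∃ ν ≠ μ, ‖root n ν - root n μ‖ ≤ ε := by
  have h_nonneg : ∀ x, 0 ≤ 1 + y x := fun x => by linarith [(abs_le.mp (hyε x)).1]
  have y_integrable : Integrable y (μ : Measure Ω) :=
    Integrable.of_bound hy.aestronglyMeasurable ε (Filter.Eventually.of_forall hyε)
  have lintegral_eq : ∫⁻ x, ENNReal.ofReal (1 + y x) ∂(μ : Measure Ω) = 1 := by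
    have h := ofReal_integral_eq_lintegral_ofReal ((integrable_const (1 : ℝ)).add y_integrable)
      (Filter.Eventually.of_forall h_nonneg)
    refine h.symm.trans ?_
    rw [integral_add' (integrable_const 1) y_integrable, hy_int]
    simp
  let ν : ProbabilityMeasure Ω :=
    ⟨(μ : Measure Ω).withDensity fun x => ENNReal.ofReal (1 + y x),
      ⟨by rw [withDensity_apply _ MeasurableSet.univ, setLIntegral_univ, lintegral_eq]⟩⟩
  refine ⟨ν, fun heq => hy_ne ?_, norm_root_sub_root_le_of_withDensity hy hyε hε rfl⟩
  have h_density : (μ : Measure Ω).withDensity (fun x => ENNReal.ofReal (1 + y x)) =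
      (μ : Measure Ω).withDensity 1 :=
    (congrArg ((↑) : ProbabilityMeasure Ω → Measure Ω) heq).trans withDensity_one.symm
  filter_upwards [(withDensity_eq_iff_of_sigmaFinite (hy.const_add 1).ennreal_ofReal.aemeasurable
    aemeasurable_one).mp h_density] with x hx
  exact add_eq_left.mp (ENNReal.ofReal_eq_one.mp hx)

theorem simpleTangent_eq_zero_of_ae_eq {μ : ProbabilityMeasure Ω} {s : SimpleFunc Ω ℝ}
    (hs : s =ᵐ[(μ : Measure Ω)] fun _ => ∫ x, s x ∂(μ : Measure Ω)) : simpleTangent n μ s = 0 := by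
  have h : simpleLp n (toFin μ) s = simpleLp n _ (SimpleFunc.const Ω (∫ x, s x ∂(μ : Measure Ω))) :=
    Lp.ext (((coeFn_simpleLp _ s).trans hs).trans (coeFn_simpleLp (toFin μ) _).symm)
  rw [← simpleTangent_const μ (∫ x, s x ∂(μ : Measure Ω))]
  exact Subtype.ext (congrArg (fun φ => center n μ (dominated n (toFin μ) φ)) h)

theorem exists_simpleTangent_ne_zero {μ : ProbabilityMeasure Ω} {V : tangent n μ} (hV : V ≠ 0) :
    ∃ s, simpleTangent n μ s ≠ 0 := by
  by_contra! h
  have := mem_closure_range_simpleTangent V.2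
  simp only [h, Submodule.coe_zero, Set.range_const, closure_singleton, Set.mem_singleton_iff,
    Submodule.coe_eq_zero] at this
  exact hV this

theorem mem_closure_compl_singleton {μ : ProbabilityMeasure Ω} {V : tangent n μ} (hV : V ≠ 0) :
    toProbRoot n μ ∈ closure {toProbRoot n μ}ᶜ := by
  obtain ⟨s, hs⟩ := exists_simpleTangent_ne_zero hV
  let y : SimpleFunc Ω ℝ := s - SimpleFunc.const Ω (∫ x, s x ∂(μ : Measure Ω))
  obtain ⟨C, hC⟩ := y.exists_forall_norm_le
  have hy_int : ∫ x, y x ∂(μ : Measure Ω) = 0 := by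
    change ∫ x, (s x - ∫ x, s x ∂(μ : Measure Ω)) ∂(μ : Measure Ω) = 0
    rw [integral_sub (s.integrable_of_isFiniteMeasure) (integrable_const _)]
    simp
  have hy_ne : ¬ y =ᵐ[(μ : Measure Ω)] 0 := fun h => hs (simpleTangent_eq_zero_of_ae_eq
    (h.mono fun x hx => sub_eq_zero.mp hx))
  rw [Metric.mem_closure_iff]
  intro ε hε
  let δ := min (ε / 2) 1
  have hδ : 0 < δ / max C 1 := by positivity
  have hyδ : ∀ x, |δ / max C 1 * y x| ≤ δ := fun x => by
    rw [abs_mul, abs_of_pos hδ]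
    exact (mul_le_mul_of_nonneg_left ((hC x).trans (le_max_left C 1)) hδ.le).trans_eq
      (div_mul_cancel₀ δ (by positivity))
  obtain ⟨ν, hν, hνμ⟩ := exists_ne_norm_root_sub_root_le (n := n) (μ := μ)
    (y.measurable.const_mul _) hyδ (min_le_right _ _)
    (by rw [integral_const_mul, hy_int, mul_zero])
    (fun h => hy_ne (h.mono fun x hx => (mul_eq_zero.mp hx).resolve_left hδ.ne'))
  refine ⟨toProbRoot n ν, hν, ?_⟩
  rw [dist_comm, ← isometry_root.dist_eq, dist_eq_norm]
  exact (hνμ.trans (min_le_left _ _)).trans_lt (half_lt_self hε)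

theorem form_eq_canonicalForm {Ψ : TensorField n Ω n} {c : ℝ}
    (h : ∀ ν : ProbabilityMeasure Ω, AgreesOnSimple Ψ c ν) (μ : ProbabilityMeasure Ω)
    (V : Fin n → tangent n μ) :
    Ψ.form μ V = c * canonicalForm n fun i => (V i : RootSpace n Ω) := by
  by_cases hV : V 0 = 0
  · have hcanonical : (canonicalMultilinear Ω n fun i => (V i : RootSpace n Ω)) = 0 :=
      (canonicalMultilinear Ω n).map_coord_zero 0 (congrArg Subtype.val hV)
    rw [(Ψ.form μ).map_coord_zero 0 hV]
    exact (mul_eq_zero_of_right c hcanonical).symm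
  choose X hXμ s hXν using fun i => exists_vectorField_eq_simpleTangent (toProbRoot n μ) (V i)
  have agree := (isClosed_setOf_form_eq_mul_canonicalForm Ψ c X).closure_subset_iff.mpr
    (fun ν hν => ?_) (mem_closure_compl_singleton hV)
  · simp only [Set.mem_ofPred_eq, hXμ] at agree
    exact agree
  · have hX : ∀ i, (X i).toFun ν = simpleTangent n ν.measure (s i ν hν) := fun i => hXν i ν hν
    simp only [Set.mem_ofPred_eq, hX]
    exact h ν.measure fun i => s i ν hν

end NotIsolated

section ModelTangency

variable {Ω : Type u} [MeasurableSpace Ω] {n : ℕ} [NeZero n]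

theorem norm_root (μ : ProbabilityMeasure Ω) : ‖root n μ‖ = 1 := by
  have hn : (n : ℝ≥0∞) ≠ 0 := Nat.cast_ne_zero.mpr (NeZero.ne n)
  rw [root, norm_dominated, Lp.norm_toLp,
    eLpNorm_const (1 : ℝ) hn (IsProbabilityMeasure.ne_zero (toFin μ).val)]
  simp

theorem meanAt_root_le_one (μ ν : ProbabilityMeasure Ω) : meanAt n μ (root n ν) ≤ 1 := by
  have hn : (n : ℝ) ^ n ≠ 0 := pow_ne_zero _ (Nat.cast_ne_zero.mpr (NeZero.ne n))
  have norm_eq : ∀ i, ‖Function.update (fun _ => root n μ) (0 : Fin n) (root n ν) i‖ = 1 :=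
    fun i => by rcases eq_or_ne i 0 with rfl | hi <;> simp [norm_root, *]
  have h := (le_abs_self _).trans
    (norm_canonicalForm_le (Function.update (fun _ => root n μ) (0 : Fin n) (root n ν)))
  simp only [norm_eq, Finset.prod_const_one, mul_one] at h
  rw [meanAt_apply]
  exact inv_mul_le_one_of_le₀ h (by positivity)

theorem trans_simpleLp_nonneg {μ ρ : FinMeasure Ω} (h : μ ≤ ρ) {s : SimpleFunc Ω ℝ}
    (hs : ∀ x, 0 ≤ s x) : ∀ᵐ x ∂ρ.val, 0 ≤ trans n μ ρ h (simpleLp n μ s) x := by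
  filter_upwards [coeFn_trans_simpleLp (n := n) h s] with x hx
  rw [hx]
  exact mul_nonneg (hs x) (Real.rpow_nonneg ENNReal.toReal_nonneg _)

theorem canonicalForm_update_simpleRoot_nonneg (ρ : FinMeasure Ω) {s : SimpleFunc Ω ℝ}
    (hs : ∀ x, 0 ≤ s x) (ν : ProbabilityMeasure Ω) :
    0 ≤ canonicalForm n (Function.update (fun _ => simpleRoot n ρ s) 0 (root n ν)) := by
  obtain ⟨τ, hρ, hν⟩ := exists_ge_ge ρ (toFin ν)
  have hs_eq : simpleRoot n ρ s = dominated n τ (trans n _ _ hρ (simpleLp n ρ s)) :=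
    (dominated_trans hρ _).symm
  have hν_eq : root n ν = dominated n τ (trans n _ _ hν (simpleLp n (toFin ν) 1)) :=
    (dominated_trans hν _).symm
  rw [hs_eq, hν_eq, canonicalForm_update_dominated]
  refine mul_nonneg (by positivity) (integral_nonneg_of_ae ?_)
  filter_upwards [trans_simpleLp_nonneg (n := n) hρ hs,
    trans_simpleLp_nonneg (n := n) hν (s := 1) fun _ => zero_le_one] with x hx hx'
  exact mul_nonneg hx' (Finset.prod_nonneg fun _ _ => hx)

theorem canonicalForm_update_indicator (hn : 2 ≤ n) (ρ : FinMeasure Ω) (w : Lp ℝ n ρ.val)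
    {B : Set Ω} (hB : MeasurableSet B) :
    canonicalForm n (Function.update (fun _ => simpleRoot n ρ (SimpleFunc.restrict 1 B)) 0
      (dominated n ρ w)) = (n : ℝ) ^ n * ∫ x in B, w x ∂ρ.val := by
  refine (canonicalForm_update_dominated ρ _ 0 w).trans ?_
  rw [← integral_indicator hB]
  congr 1
  refine integral_congr_ae ?_
  have hcard : (Finset.univ \ {(0 : Fin n)}).card ≠ 0 := by
    rw [Finset.card_sdiff, Finset.inter_univ, Finset.card_singleton, Finset.card_fin]
    omega
  filter_upwards [coeFn_simpleLp (n := n) ρ (SimpleFunc.restrict 1 B)] with x hx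
  rw [Finset.prod_const, hx, SimpleFunc.restrict_apply _ hB]
  by_cases h : x ∈ B <;> simp [h, hcard]

theorem setIntegral_trans_simpleLp_one_eq_zero {μ ρ : FinMeasure Ω} (h : μ ≤ ρ) {B : Set Ω}
    (hBμ : μ.val B = 0) :
    ∫ x in B, trans n μ ρ h (simpleLp n μ 1) x ∂ρ.val = 0 := by
  have rnDeriv_eq_zero : ∀ᵐ x ∂ρ.val.restrict B, μ.val.rnDeriv ρ.val x = 0 := by
    refine (lintegral_eq_zero_iff (Measure.measurable_rnDeriv _ _)).mp ?_
    rw [Measure.setLIntegral_rnDeriv h, hBμ]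
  refine integral_eq_zero_of_ae ?_
  filter_upwards [rnDeriv_eq_zero,
    ae_restrict_of_ae (coeFn_trans_simpleLp (n := n) h (1 : SimpleFunc Ω ℝ))] with x hx htrans
  rw [htrans, transFun, hx]
  simp [NeZero.ne n]

theorem mem_range_dominated {μ ρ : FinMeasure Ω} (h : μ ≤ ρ) {w : Lp ℝ n ρ.val}
    (hw : ∀ᵐ x ∂ρ.val, (μ.val.rnDeriv ρ.val x).toReal = 0 → w x = 0) :
    dominated n ρ w ∈ LinearMap.range (dominated n μ) := by
  let b : Ω → ℝ := fun x => (μ.val.rnDeriv ρ.val x).toReal ^ ((n : ℝ)⁻¹)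
  have b_eq_zero : ∀ x, b x = 0 → (μ.val.rnDeriv ρ.val x).toReal = 0 := fun x hx =>
    ((Real.rpow_eq_zero_iff_of_nonneg ENNReal.toReal_nonneg).mp hx).1
  have quotient_meas : StronglyMeasurable fun x => w x / b x :=
    ((Lp.stronglyMeasurable w).measurable.div
      ((Measure.measurable_rnDeriv _ _).ennreal_toReal.pow_const _)).stronglyMeasurable
  have w_eq : w =ᵐ[ρ.val] transFun n μ.val ρ.val fun x => w x / b x := by
    filter_upwards [hw] with x hx
    exact (div_mul_cancel_of_imp fun hb => hx (b_eq_zero x hb)).symm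
  have quotient_memLp : MemLp (fun x => w x / b x) n μ.val := by
    refine ⟨quotient_meas.aestronglyMeasurable, ?_⟩
    rw [← eLpNorm_transFun n h quotient_meas, ← eLpNorm_congr_ae w_eq]
    exact Lp.eLpNorm_lt_top w
  refine ⟨quotient_memLp.toLp _, ?_⟩
  rw [← dominated_trans h]
  congr 1
  exact Lp.ext ((coeFn_trans n h _).trans
    ((transFun_congr n h quotient_memLp.coeFn_toLp).trans w_eq.symm))

variable {E : Type*} [NormedAddCommGroup E] [NormedSpace ℝ E] {H : Type*} [TopologicalSpace H]
  {I : ModelWithCorners ℝ E H} {M : Type*} [TopologicalSpace M] [ChartedSpace H M]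
  [BoundarylessManifold I M]

theorem apply_mfderiv_eq_zero_of_isMin {F : Type*} [NormedAddCommGroup F] [NormedSpace ℝ F]
    {f : M → F} {ξ : M} (hf : MDifferentiableAt I 𝓘(ℝ, F) f ξ) (ℓ : F →L[ℝ] ℝ)
    (hmin : ∀ η, ℓ (f ξ) ≤ ℓ (f η)) (v : TangentSpace I ξ) :
    ℓ (mfderiv I 𝓘(ℝ, F) f ξ v) = 0 := by
  let g : E → F := f ∘ (extChartAt I ξ).symm
  let g' : E →L[ℝ] F := mfderiv I 𝓘(ℝ, F) f ξ
  have hg : HasFDerivAt g g' (extChartAt I ξ ξ) := by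
    have h : HasFDerivWithinAt g g' (Set.range I) (extChartAt I ξ ξ) := hf.hasMFDerivAt.2
    exact h.hasFDerivAt (mem_interior_iff_mem_nhds.mp
      (BoundarylessManifold.isInteriorPoint (I := I) (x := ξ)))
  have g_base : g (extChartAt I ξ ξ) = f ξ := congrArg f (extChartAt_to_inv ξ)
  have hloc : IsLocalMin (ℓ ∘ g) (extChartAt I ξ ξ) := Filter.Eventually.of_forall fun e => by
    rw [Function.comp_apply, g_base]
    exact hmin _
  exact DFunLike.congr_fun (hloc.hasFDerivAt_eq_zero (ℓ.hasFDerivAt.comp _ hg)) v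

theorem setIntegral_rootDeriv_eq_zero (hn : 2 ≤ n) {p : M → ProbabilityMeasure Ω} {ξ : M}
    (hp : MDifferentiableAt I 𝓘(ℝ, RootSpace n Ω) (fun η => root n (p η)) ξ)
    {v : TangentSpace I ξ} {ρ : FinMeasure Ω} (hρ : toFin (p ξ) ≤ ρ) {w : Lp ℝ n ρ.val}
    (hw : rootDeriv I n p ξ v = dominated n ρ w) {B : Set Ω} (hB : MeasurableSet B)
    (hpB : (p ξ : Measure Ω) B = 0) : ∫ x in B, w x ∂ρ.val = 0 := by
  let ℓ : RootSpace n Ω →L[ℝ] ℝ := (canonicalMultilinear Ω n).toContinuousLinearMap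
    (fun _ => simpleRoot n ρ (SimpleFunc.restrict 1 B)) 0
  have ℓ_dominated : ∀ φ, ℓ (dominated n ρ φ) = (n : ℝ) ^ n * ∫ x in B, φ x ∂ρ.val := fun φ =>
    canonicalForm_update_indicator hn ρ φ hB
  have ℓ_root : ℓ (root n (p ξ)) = 0 := by
    rw [← simpleRoot_one, simpleRoot, LinearMap.comp_apply, ← dominated_trans hρ, ℓ_dominated,
      setIntegral_trans_simpleLp_one_eq_zero hρ hpB, mul_zero]
  have ℓ_deriv : ℓ (rootDeriv I n p ξ v) = 0 :=
    apply_mfderiv_eq_zero_of_isMin hp ℓ (fun η => ℓ_root.le.trans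
      (canonicalForm_update_simpleRoot_nonneg ρ (fun x => by
        rw [SimpleFunc.restrict_apply _ hB]
        exact Set.indicator_nonneg (fun _ _ => zero_le_one) x) (p η))) v
  rw [hw, ℓ_dominated] at ℓ_deriv
  exact (mul_eq_zero.mp ℓ_deriv).resolve_left
    (pow_ne_zero _ (Nat.cast_ne_zero.mpr (NeZero.ne n)))

theorem rootDeriv_mem_range_dominated (hn : 2 ≤ n) {p : M → ProbabilityMeasure Ω} {ξ : M}
    (hp : MDifferentiableAt I 𝓘(ℝ, RootSpace n Ω) (fun η => root n (p η)) ξ)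
    (v : TangentSpace I ξ) :
    rootDeriv I n p ξ v ∈ LinearMap.range (dominated n (toFin (p ξ))) := by
  obtain ⟨ρ', w', hw'⟩ := exists_dominated (rootDeriv I n p ξ v)
  obtain ⟨ρ, hρ', hρ⟩ := exists_ge_ge ρ' (toFin (p ξ))
  obtain ⟨w, hw⟩ : ∃ w, rootDeriv I n p ξ v = dominated n ρ w :=
    ⟨_, hw'.trans (dominated_trans hρ' w').symm⟩
  rw [hw]
  refine mem_range_dominated hρ ?_
  let N : Set Ω := {x | ((p ξ : Measure Ω).rnDeriv ρ.val x).toReal = 0}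
  have hN : MeasurableSet N :=
    (Measure.measurable_rnDeriv _ _).ennreal_toReal (measurableSet_singleton 0)
  have hpN : (p ξ : Measure Ω) N = 0 := by
    rw [measure_eq_zero_iff_ae_notMem]
    have hac : (p ξ : Measure Ω) ≪ ρ.val := hρ
    filter_upwards [Measure.rnDeriv_pos hac, hac.ae_le ((p ξ : Measure Ω).rnDeriv_lt_top ρ.val)]
      with x h_pos h_lt
    exact (ENNReal.toReal_pos h_pos.ne' h_lt.ne).ne'
  refine (ae_restrict_iff' hN).mp (Integrable.ae_eq_zero_of_forall_setIntegral_eq_zero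
    (integrable_coe w).integrableOn fun B hB _ => ?_)
  rw [Measure.restrict_restrict hB]
  exact setIntegral_rootDeriv_eq_zero hn hp hρ hw (hB.inter hN)
    (measure_mono_null Set.inter_subset_right hpN)

-- By Hölder's inequality `meanAt n (p ξ)` is maximal on `P^{1/n}(Ω)` at `p(ξ)^{1/n}`.
theorem rootDeriv_mem_tangent (hn : 2 ≤ n) {p : M → ProbabilityMeasure Ω} {ξ : M}
    (hp : MDifferentiableAt I 𝓘(ℝ, RootSpace n Ω) (fun η => root n (p η)) ξ)
    (v : TangentSpace I ξ) : rootDeriv I n p ξ v ∈ tangent n (p ξ) := by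
  have h : (-meanAt n (p ξ)) (rootDeriv I n p ξ v) = 0 :=
    apply_mfderiv_eq_zero_of_isMin hp (-meanAt n (p ξ))
      (fun η => neg_le_neg ((meanAt_root_le_one _ _).trans_eq (meanAt_root _).symm)) v
  exact mem_tangent_iff.mpr ⟨rootDeriv_mem_range_dominated hn hp v, neg_eq_zero.mp h⟩

end ModelTangency

section Classification

theorem exists_form_eq_canonicalForm {n : ℕ} [NeZero n] (h2 : 2 ≤ n) (h3 : n ≤ 3)
    {Θ : ∀ (Ω : Type u) [MeasurableSpace Ω], TensorField n Ω n} (hΘ : IsCongruentFamily Θ) :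
    ∃ c : ℝ, ∀ (Ω : Type u) [MeasurableSpace Ω] (μ : ProbabilityMeasure Ω)
      (V : Fin n → tangent n μ),
      (Θ Ω).form μ V = c * canonicalForm n fun i => (V i : RootSpace n Ω) := by
  obtain ⟨c, hc⟩ := exists_agreesOnSimple_uniformProb_forall h2 h3 hΘ
  exact ⟨c, fun _ _ => form_eq_canonicalForm (agreesOnSimple_of_uniformProb hΘ hc)⟩

end Classification

end RootMeasure

end

theorem mainTheorem3 :
    (∀ Θ : ∀ (Ω : Type u) [MeasurableSpace Ω], RootMeasure.TensorField 2 Ω 2,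
      RootMeasure.IsCongruentFamily Θ →
      ∃ c : ℝ,
        (∀ (Ω : Type u) [MeasurableSpace Ω] (μ : ProbabilityMeasure Ω)
          (V : Fin 2 → RootMeasure.tangent 2 μ),
          (Θ Ω).form μ V = c * RootMeasure.fisherMetric μ V) ∧
        (∀ (Ω : Type u) [MeasurableSpace Ω]
          (E : Type v) [NormedAddCommGroup E] [NormedSpace ℝ E]
          (H : Type w) [TopologicalSpace H] (I : ModelWithCorners ℝ E H)
          (M : Type x) [TopologicalSpace M] [ChartedSpace H M] [IsManifold I 1 M]
          [BoundarylessManifold I M] (p : M → ProbabilityMeasure Ω),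
          RootMeasure.IsIntegrableModel I 2 p →
          ∃ h : ∀ ξ v, RootMeasure.rootDeriv I 2 p ξ v ∈ RootMeasure.tangent 2 (p ξ),
            ∀ (ξ : M) (v : Fin 2 → TangentSpace I ξ),
              RootMeasure.modelPullback I p h (Θ Ω) ξ v =
                c * RootMeasure.modelTensor I 2 p ξ v)) ∧
    (∀ Θ : ∀ (Ω : Type u) [MeasurableSpace Ω], RootMeasure.TensorField 3 Ω 3,
      RootMeasure.IsCongruentFamily Θ →
      ∃ c : ℝ,
        (∀ (Ω : Type u) [MeasurableSpace Ω] (μ : ProbabilityMeasure Ω)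
          (V : Fin 3 → RootMeasure.tangent 3 μ),
          (Θ Ω).form μ V = c * RootMeasure.amariChentsov μ V) ∧
        (∀ (Ω : Type u) [MeasurableSpace Ω]
          (E : Type v) [NormedAddCommGroup E] [NormedSpace ℝ E]
          (H : Type w) [TopologicalSpace H] (I : ModelWithCorners ℝ E H)
          (M : Type x) [TopologicalSpace M] [ChartedSpace H M] [IsManifold I 1 M]
          [BoundarylessManifold I M] (p : M → ProbabilityMeasure Ω),
          RootMeasure.IsIntegrableModel I 3 p →
          ∃ h : ∀ ξ v, RootMeasure.rootDeriv I 3 p ξ v ∈ RootMeasure.tangent 3 (p ξ),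
            ∀ (ξ : M) (v : Fin 3 → TangentSpace I ξ),
              RootMeasure.modelPullback I p h (Θ Ω) ξ v =
                c * RootMeasure.modelTensor I 3 p ξ v)) := by
  refine ⟨fun Θ hΘ => ?_, fun Θ hΘ => ?_⟩
  · obtain ⟨c, hc⟩ := RootMeasure.exists_form_eq_canonicalForm le_rfl (Nat.le_succ 2) hΘ
    exact ⟨c, hc, fun Ω _ E _ _ H _ I M _ _ _ _ p hp =>
      ⟨fun ξ => RootMeasure.rootDeriv_mem_tangent le_rfl (hp.mdifferentiable_root ξ),
        fun ξ v => hc Ω (p ξ) _⟩⟩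
  · obtain ⟨c, hc⟩ := RootMeasure.exists_form_eq_canonicalForm (Nat.le_succ 2) le_rfl hΘ
    exact ⟨c, hc, fun Ω _ E _ _ H _ I M _ _ _ _ p hp =>
      ⟨fun ξ => RootMeasure.rootDeriv_mem_tangent (Nat.le_succ 2) (hp.mdifferentiable_root ξ),
        fun ξ v => hc Ω (p ξ) _⟩⟩
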